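/- **Proposition.** Let $m\in\mathbb N$ and let $\mathcal H=L^2(\mathbb C^m)$ with respect to Lebesgue measure, with coordinates $z_k=x_k+\mathrm i y_k$. For $k=1,\dots,m$ let $b_k=\frac{\partial}{\partial\bar z_k}+\frac{z_k}{2}$, where the derivative is taken in the weak sense and the domain consists of all $\psi\in\mathcal H$ with $b_k\psi\in\mathcal H$. Let $N_b=\sum_{k=1}^m b_k^*b_k$, and let $E_b$ be the orthogonal projection of $\mathcal H$ onto $\ker N_b$. For a function $f:\mathbb C^m\to\mathbb C$, acting on $\mathcal H$ by multiplication, let $\mathcal E_b(f):=E_b f E_b$ (the antinormally ordered quantization of $f$), with domain $\{\psi\in\mathcal H: fE_b\psi\in\mathcal H\}$; it vanishes on the orthogonal complement of $\ker N_b$. Let $$\mathcal A\in\mathfrak{sp}_c(2m,\mathbb R)=\left\{\begin{pmatrix}A&B\\ \bar B&\bar A\end{pmatrix}: A,B\in\mathrm{Mat}(m,\mathbb C),\ A^*=-A,\ B^{\mathsf T}=B\right\},$$ and define the (pure imaginary) Hamiltonian function $$h_{\mathcal A}(\vec z)=\tfrac12\,\mathbf z^*\begin{pmatrix}-I_m&0\\0&I_m\end{pmatrix}\mathcal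 A\,\mathbf z,\qquad \mathbf z=(\bar z_1,\dots,\bar z_m,z_1,\dots,z_m)^{\mathsf T},\quad \mathbf z^*=(z_1,\dots,z_m,\bar z_1,\dots,\bar z_m),$$ and, for $\tau>0$, the bounded cutoff Hamiltonian $$h_{\mathcal A}^{(\tau)}(\vec z)=\tfrac1{\mathrm i}\max\{\min\{\mathrm i\,h_{\mathcal A}(\vec z),\tau\},-\tau\}.$$ Then the operators $\mathcal E_b(h_{\mathcal A})$ and $\mathcal E_b(h_{\mathcal A}^{(\tau)})$, $\tau>0$, are essentially skew-adjoint (that is, the closures of $\mathrm i\,\mathcal E_b(h_{\mathcal A})$ and $\mathrm i\,\mathcal E_b(h_{\mathcal A}^{(\tau)})$ are self-adjoint), so that the closure of each of them generates a unique strongly continuous one-parameter unitary group on $\mathcal H$, denoted by $e^{t\mathcal E_b(h_{\mathcal A})}$ and $e^{t\mathcal E_b(h_{\mathcal A}^{(\tau)})}$ respectively, and for every $t\in\mathbb R$ $$\operatorname*{s-lim}_{\tau\to\infty}e^{t\mathcal E_b(h_{\mathcal A}^{(\tau)})}=e^{t\mathcal E_b(h_{\mathcal A})}.$$ -/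

import Mathlib

open MeasureTheory Filter Topology
open scoped ContDiff Matrix

namespace AntinormalQuantization

noncomputable section

/-! ### Unbounded operators -/

section Operators

variable {H : Type*} [NormedAddCommGroup H] [InnerProductSpace ℂ H]

/-- The product `S T` of two unbounded operators, with its natural domain
`{x ∈ dom T | T x ∈ dom S}`. -/
def opMul (S T : H →ₗ.[ℂ] H) : H →ₗ.[ℂ] H where
  domain := (S.domain.comap T.toFun).map T.domain.subtype
  toFun :=
    { toFun := fun x => S ⟨T ⟨x.1, by
          obtain ⟨y, -, hy⟩ := x.2
          exact hy ▸ y.2⟩, by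
          obtain ⟨x, y, hy, rfl⟩ := x
          exact hy⟩
      map_add' := by
        intro x y
        rw [← LinearPMap.map_add]
        congr 1
        apply Subtype.ext
        exact LinearPMap.map_add T ⟨x.1, _⟩ ⟨y.1, _⟩
      map_smul' := by
        intro c x
        rw [RingHom.id_apply, ← LinearPMap.map_smul]
        congr 1
        apply Subtype.ext
        exact LinearPMap.map_smul T c ⟨x.1, _⟩ }

/-- A bounded operator, seen as an unbounded operator with full domain. -/
def ofBounded (T : H →L[ℂ] H) : H →ₗ.[ℂ] H := (T : H →ₗ[ℂ] H).toPMap ⊤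

/-- The kernel `{x ∈ dom T | T x = 0}` as a subspace of `H`. -/
def opKer (T : H →ₗ.[ℂ] H) : Submodule ℂ H := (LinearMap.ker T.toFun).map T.domain.subtype

variable [CompleteSpace H]

/-- `T` is essentially skew-adjoint: the closure of `i T` is self-adjoint
(in particular `T` is densely defined). -/
def IsEssentiallySkewAdjoint (T : H →ₗ.[ℂ] H) : Prop :=
  IsSelfAdjoint (Complex.I • T).closure

/-- `U` is a strongly continuous one-parameter group of unitary operators on `H`, whose
infinitesimal generator (with domain all `x` for which `t ↦ U t x` is differentiable at `0`) is
the closure of `T`. -/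
structure IsUnitaryGroupGeneratedBy (U : ℝ → H →L[ℂ] H) (T : H →ₗ.[ℂ] H) : Prop where
  unitary : ∀ t, U t ∈ unitary (H →L[ℂ] H)
  map_zero : U 0 = 1
  map_add : ∀ s t, U (s + t) = U s * U t
  continuous : ∀ x, Continuous fun t => U t x
  generator : ∀ x y, (x, y) ∈ T.closure.graph ↔ HasDerivAt (fun t => U t x) y 0

open scoped Classical in
/-- The unitary operators `e^{tT}`, `t ∈ ℝ`: the strongly continuous unitary group generated by
(the closure of) `T`, and the junk value `0` if there is none. -/
def unitaryExp (T : H →ₗ.[ℂ] H) : ℝ → H →L[ℂ] H :=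
  if h : ∃ U, IsUnitaryGroupGeneratedBy U T then h.choose else 0

end Operators

/-! ### The phase space `ℂ^m` and the Hilbert space `L²(ℂ^m)` -/

/-- `L²(ℂ^m)` with respect to Lebesgue measure `dx₁ dy₁ ⋯ dx_m dy_m`. -/
abbrev L2 (m : ℕ) : Type := Lp ℂ 2 (volume : Measure (Fin m → ℂ))

/-- The Wirtinger derivative `∂φ/∂z̄_k = (∂φ/∂x_k + i ∂φ/∂y_k) / 2`. -/
def dbar {m : ℕ} (k : Fin m) (φ : (Fin m → ℂ) → ℂ) (z : Fin m → ℂ) : ℂ :=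
  (fderiv ℝ φ z (Pi.single k 1) + Complex.I * fderiv ℝ φ z (Pi.single k Complex.I)) / 2

/-- The formal transpose `φ ↦ -∂φ/∂z̄_k + (z_k / 2) φ` of `∂/∂z̄_k + z_k / 2`. -/
def annihilationTranspose {m : ℕ} (k : Fin m) (φ : (Fin m → ℂ) → ℂ) (z : Fin m → ℂ) : ℂ :=
  -dbar k φ z + z k / 2 * φ z

/-- Test functions: smooth with compact support. -/
def IsTestFunction {m : ℕ} (φ : (Fin m → ℂ) → ℂ) : Prop :=
  ContDiff ℝ ∞ φ ∧ HasCompactSupport φ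

lemma IsTestFunction.memLp {m : ℕ} {φ : (Fin m → ℂ) → ℂ} (h : IsTestFunction φ) :
    MemLp φ 2 volume :=
  h.1.continuous.memLp_of_hasCompactSupport h.2

lemma IsTestFunction.memLp_transpose {m : ℕ} {φ : (Fin m → ℂ) → ℂ} (h : IsTestFunction φ)
    (k : Fin m) : MemLp (annihilationTranspose k φ) 2 volume := by
  have hd : Continuous (fderiv ℝ φ) := h.1.continuous_fderiv (by simp)
  have hc := h.1.continuous
  refine Continuous.memLp_of_hasCompactSupport ?_ ?_
  · unfold annihilationTranspose dbar
    fun_prop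
  · have h1 := h.2.fderiv_apply (𝕜 := ℝ) (Pi.single k (1 : ℂ))
    have h2 := h.2.fderiv_apply (𝕜 := ℝ) (Pi.single k Complex.I)
    have h3 : HasCompactSupport (fun z => z k / 2 * φ z) := h.2.mul_left
    have h4 : HasCompactSupport (fun z => Complex.I * fderiv ℝ φ z (Pi.single k Complex.I)) :=
      h2.mul_left
    have h5 : HasCompactSupport (dbar k φ) := by
      have := (h1.add h4).mul_right (f' := fun _ => (2 : ℂ)⁻¹)
      simpa only [dbar, div_eq_mul_inv] using! this
    exact h5.neg.add h3

lemma integrable_mul {m : ℕ} {φ : (Fin m → ℂ) → ℂ} (h : MemLp φ 2 volume) (ψ : L2 m) :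
    Integrable (fun z => ψ z * φ z) :=
  (Lp.memLp ψ).integrable_mul h

/-- The graph of `b_k = ∂/∂z̄_k + z_k / 2`, in the sense of weak derivatives: the pairs
`(ψ, η)` in `L²` with `∫ η φ = ∫ ψ (-∂φ/∂z̄_k + (z_k / 2) φ)` for all test functions `φ`. -/
def annihilationGraph (m : ℕ) (k : Fin m) : Submodule ℂ (L2 m × L2 m) where
  carrier := {p | ∀ φ : (Fin m → ℂ) → ℂ, IsTestFunction φ →
    ∫ z, p.2 z * φ z = ∫ z, p.1 z * annihilationTranspose k φ z}
  zero_mem' := by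
    intro φ _
    have h : ∀ f : (Fin m → ℂ) → ℂ, ∫ z, (0 : L2 m) z * f z = 0 := by
      intro f
      rw [← integral_zero (Fin m → ℂ) ℂ]
      apply integral_congr_ae
      filter_upwards [Lp.coeFn_zero ℂ 2 (volume : Measure (Fin m → ℂ))] with z hz
      simp
    exact (h _).trans (h _).symm
  add_mem' := by
    intro p q hp hq φ hφ
    have h : ∀ (f : (Fin m → ℂ) → ℂ), MemLp f 2 volume → ∀ u v : L2 m,
        ∫ z, (u + v) z * f z = (∫ z, u z * f z) + ∫ z, v z * f z := by
      intro f hf u v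
      rw [← integral_add (integrable_mul hf u) (integrable_mul hf v)]
      apply integral_congr_ae
      filter_upwards [Lp.coeFn_add u v] with z hz
      rw [hz, Pi.add_apply, add_mul]
    rw [Prod.snd_add, Prod.fst_add, h _ hφ.memLp, h _ (hφ.memLp_transpose k), hp φ hφ, hq φ hφ]
  smul_mem' := by
    intro c p hp φ hφ
    have h : ∀ (f : (Fin m → ℂ) → ℂ) (u : L2 m),
        ∫ z, (c • u) z * f z = c * ∫ z, u z * f z := by
      intro f u
      rw [← integral_const_mul]
      apply integral_congr_ae
      filter_upwards [Lp.coeFn_smul c u] with z hz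
      simp [hz, mul_assoc]
    rw [Prod.smul_snd, Prod.smul_fst, h, h, hp φ hφ]

/-- The weak image `b_k ψ` is unique, so that `annihilationGraph` is the graph of an operator. -/
lemma annihilationGraph_unique {m : ℕ} {k : Fin m} {p : L2 m × L2 m}
    (hp : p ∈ annihilationGraph m k) (h0 : p.1 = 0) : p.2 = 0 := by
  have hae : ∀ᵐ z, p.2 z = 0 := by
    refine ae_eq_zero_of_integral_contDiff_smul_eq_zero
      ((Lp.memLp p.2).locallyIntegrable (by norm_num)) ?_
    intro g hg hgs
    have ht : IsTestFunction (fun z => (g z : ℂ)) :=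
      ⟨Complex.ofRealCLM.contDiff.comp hg, hgs.comp_left (g := Complex.ofReal) (by simp)⟩
    have h1 := hp _ ht
    have h2 : ∫ z, p.1 z * annihilationTranspose k (fun z => (g z : ℂ)) z = 0 := by
      rw [h0, ← integral_zero (Fin m → ℂ) ℂ]
      apply integral_congr_ae
      filter_upwards [Lp.coeFn_zero ℂ 2 (volume : Measure (Fin m → ℂ))] with z hz
      simp
    rw [h2] at h1
    simpa [mul_comm] using h1
  apply Lp.ext
  filter_upwards [hae, Lp.coeFn_zero ℂ 2 (volume : Measure (Fin m → ℂ))] with z hz hz'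
  rw [hz, hz']
  rfl

/-- The annihilation operator `b_k = ∂/∂z̄_k + z_k / 2` on `L²(ℂ^m)`, with domain all `ψ ∈ L²`
for which `∂ψ/∂z̄_k + (z_k / 2) ψ`, taken in the weak sense, is in `L²`. -/
def annihilation (m : ℕ) (k : Fin m) : L2 m →ₗ.[ℂ] L2 m :=
  (annihilationGraph m k).toLinearPMap

lemma annihilation_graph (m : ℕ) (k : Fin m) :
    (annihilation m k).graph = annihilationGraph m k :=
  Submodule.toLinearPMap_graph_eq _ fun _ hp h0 => annihilationGraph_unique hp h0

/-- The number operator `N_b = ∑_k b_k^* b_k`. -/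
def numberOp (m : ℕ) : L2 m →ₗ.[ℂ] L2 m :=
  ∑ k : Fin m, opMul (annihilation m k).adjoint (annihilation m k)

/-- `E_b`: the orthogonal projection of `L²(ℂ^m)` onto `ker N_b`. (The kernel is closed; taking
its closure only spares a proof of this fact.) -/
def vacuumProj (m : ℕ) : L2 m →L[ℂ] L2 m :=
  (opKer (numberOp m)).topologicalClosure.starProjection

/-- The multiplication operator by `f` on `L²(ℂ^m)`, with domain `{ψ ∈ L² | f ψ ∈ L²}`. -/
def mulOp {m : ℕ} (f : (Fin m → ℂ) → ℂ) : L2 m →ₗ.[ℂ] L2 m where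
  domain :=
    { carrier := {ψ | MemLp (fun z => f z * ψ z) 2 volume}
      zero_mem' := by
        refine (memLp_congr_ae ?_).mpr (MemLp.zero (μ := volume) (p := 2) (ε := ℂ))
        filter_upwards [Lp.coeFn_zero ℂ 2 (volume : Measure (Fin m → ℂ))] with z hz
        simp
      add_mem' := by
        intro u v hu hv
        refine (memLp_congr_ae ?_).mpr (MemLp.add hu hv)
        filter_upwards [Lp.coeFn_add u v] with z hz
        simp only [Pi.add_apply, hz, mul_add]
      smul_mem' := by
        intro c u hu
        refine (memLp_congr_ae ?_).mpr (MemLp.const_smul hu c)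
        filter_upwards [Lp.coeFn_smul c u] with z hz
        simp [hz, mul_left_comm] }
  toFun :=
    { toFun := fun ψ => MemLp.toLp (fun z => f z * ψ.1 z) ψ.2
      map_add' := by
        intro u v
        rw [← MemLp.toLp_add]
        apply MemLp.toLp_congr
        filter_upwards [Lp.coeFn_add u.1 v.1] with z hz
        simp only [Submodule.coe_add, Pi.add_apply, hz, mul_add]
      map_smul' := by
        intro c u
        rw [RingHom.id_apply, ← MemLp.toLp_const_smul]
        apply MemLp.toLp_congr
        filter_upwards [Lp.coeFn_smul c u.1] with z hz
        simp [hz, mul_left_comm] }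

/-- The antinormally ordered quantization `ℰ_b(f) = E_b f E_b` of `f : ℂ^m → ℂ`, where `f` acts
on `L²(ℂ^m)` by multiplication; its domain is `{ψ ∈ L² | f E_b ψ ∈ L²}`. -/
def quantization {m : ℕ} (f : (Fin m → ℂ) → ℂ) : L2 m →ₗ.[ℂ] L2 m :=
  opMul (ofBounded (vacuumProj m)) (opMul (mulOp f) (ofBounded (vacuumProj m)))

/-! ### Quadratic Hamiltonians -/

/-- The Lie algebra `𝔰𝔭_c(2m, ℝ)`: block matrices with rows `(A, B)` and `(B̄, Ā)`, where `A^* = -A` and `B^T = B`. -/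
def spc (m : ℕ) : Set (Matrix (Fin m ⊕ Fin m) (Fin m ⊕ Fin m) ℂ) :=
  {X | ∃ A B : Matrix (Fin m) (Fin m) ℂ, Aᴴ = -A ∧ Bᵀ = B ∧
    X = Matrix.fromBlocks A B (B.map (starRingEnd ℂ)) (A.map (starRingEnd ℂ))}

/-- The matrix `𝓘 = diag(-I_m, I_m)`. -/
def signMatrix (m : ℕ) : Matrix (Fin m ⊕ Fin m) (Fin m ⊕ Fin m) ℂ :=
  Matrix.fromBlocks (-1) 0 0 1

/-- The (pure imaginary) Hamiltonian function `h_X(z) = (1/2) 𝐳^* 𝓘 X 𝐳`, where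
`𝐳 = (z̄₁, …, z̄_m, z₁, …, z_m)^T` and `𝐳^* = (z₁, …, z_m, z̄₁, …, z̄_m)`. -/
def hamiltonian {m : ℕ} (X : Matrix (Fin m ⊕ Fin m) (Fin m ⊕ Fin m) ℂ) (z : Fin m → ℂ) : ℂ :=
  1 / 2 * (Sum.elim z (star z) ⬝ᵥ (signMatrix m * X) *ᵥ Sum.elim (star z) z)

/-- The values of `h_X` are pure imaginary for `X ∈ 𝔰𝔭_c(2m, ℝ)`, so `i h_X` is real. -/
lemma hamiltonian_re {m : ℕ} {X : Matrix (Fin m ⊕ Fin m) (Fin m ⊕ Fin m) ℂ} (hX : X ∈ spc m)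
    (z : Fin m → ℂ) : (hamiltonian X z).re = 0 := by
  obtain ⟨A, B, hA, hB, rfl⟩ := hX
  have key : hamiltonian (Matrix.fromBlocks A B (B.map (starRingEnd ℂ)) (A.map (starRingEnd ℂ))) z
      = 1 / 2 * (star (z ⬝ᵥ (A *ᵥ star z + B *ᵥ z)) - z ⬝ᵥ (A *ᵥ star z + B *ᵥ z)) := by
    have h1 : star (A *ᵥ star z + B *ᵥ z)
        = B.map (starRingEnd ℂ) *ᵥ star z + A.map (starRingEnd ℂ) *ᵥ z := by
      ext i
      simp [Matrix.mulVec, dotProduct, add_comm]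
    have h2 : star (z ⬝ᵥ (A *ᵥ star z + B *ᵥ z))
        = star z ⬝ᵥ star (A *ᵥ star z + B *ᵥ z) := by
      rw [Matrix.star_dotProduct_star, dotProduct_comm]
    rw [h2, h1]
    simp [hamiltonian, signMatrix, Matrix.fromBlocks_multiply, Matrix.fromBlocks_mulVec,
      Matrix.neg_mulVec]
    ring
  rw [key]
  simp

/-- The cutoff Hamiltonian `h_X^{(τ)}(z) = (1/i) max(min(i h_X(z), τ), -τ)`. -/
def cutoffHamiltonian {m : ℕ} (X : Matrix (Fin m ⊕ Fin m) (Fin m ⊕ Fin m) ℂ) (τ : ℝ)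
    (z : Fin m → ℂ) : ℂ :=
  1 / Complex.I * ((max (min (Complex.I * hamiltonian X z).re τ) (-τ) : ℝ) : ℂ)

end

end AntinormalQuantization

/-!
Up to the Gaussian factor `e^{-|z|²/2}`, the space `ker N_b` is the Segal–Bargmann space, and
`E_b h E_b` is the Toeplitz operator on it with symbol `h`. Two things have to be shown: that the
Toeplitz operator `T` of an imaginary quadratic symbol is essentially skew-adjoint, and that the
groups of the bounded Toeplitz operators `A_τ` of the cutoff symbols converge to its group.

*The vacuum space.* Since `⟪ψ, N_b ψ⟫ = ∑ ‖b_k ψ‖²`, the kernel of `N_b` is the common kernel of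
the `b_k`. It contains the vectors `p(z) e^{-|z|²/2}`, `p` a polynomial, and these are total in it
(`eq_zero_of_mem_vacuum`): the relation `b_k^* (q e^{-|z|²/2}) = (z̄_k q - ∂q/∂z_k) e^{-|z|²/2}`
makes multiplication by `z̄_k` act as `∂/∂z_k` when tested against `ker b_k`, so that a vector of
`ker N_b` orthogonal to the `p(z) e^{-|z|²/2}` is orthogonal to all `q(z, z̄) e^{-|z|²/2}`; and
those are total in `L²` by the injectivity of the Fourier transform
(`eq_zero_of_inner_gaussPoly`).

*Essential skew-adjointness.* It suffices that `1 - s T` has dense range for real `s`. Grade the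
polynomials by their degree; different degrees are orthogonal. A quadratic symbol changes the
degree by at most `2`, and its matrix elements in degree `N` are `O(N)`. If `φ` is orthogonal to
the range of `1 - s T` and `φ_n` is its part of degree `n`, then testing with
`∑_{n ≤ N + 1} φ_n` bounds `∑_{n ≤ N + 1} ‖φ_n‖²` by a multiple of
`N + 1` times `‖φ_N‖² + ⋯ + ‖φ_{N + 3}‖²`, because `T` is skew-symmetric and only the matrix
elements across the degree `N + 1` survive. As `∑ ‖φ_n‖²` converges and the harmonic series does
not, `φ = 0` (`eq_zero_of_inner_quadPoly`). This is Carleman's argument for Jacobi matrices.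

*Convergence of the groups.* By dominated convergence `A_τ ψ → T ψ` for `ψ` in the domain of `T`.
Hence the resolvents `(1 - s A_τ)⁻¹` converge strongly on the range of `1 - s T`, which is dense.
The implicit Euler scheme `(1 - (t/k) A)^{-k}` approximates `e^{tA}` on vectors `(1 - A)⁻² w` with
an error that does not depend on the norm of `A`; therefore the `e^{tA_τ}` converge strongly, and
their limit is a unitary group whose generator is the closure of `T`
(`exists_isUnitaryGroupGeneratedBy`). This version of the Trotter–Kato theorem yields the group
generated by `T` together with the convergence, with no appeal to Stone's theorem; applied to the
constant family `A_τ` it also identifies the group generated by `A_τ` with the exponential series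
`e^{tA_τ}`.
-/

namespace AntinormalQuantization

/-! ### Exponentials and resolvents of bounded skew-adjoint operators -/

section Bounded

/-- A mean value inequality around `0`. -/
lemma norm_sub_le_of_hasDerivAt {H : Type*} [NormedAddCommGroup H] [NormedSpace ℝ H]
    {f f' : ℝ → H} {t C : ℝ} (hf : ∀ r, HasDerivAt f (f' r) r)
    (hC : ∀ r, |r| ≤ |t| → ‖f' r‖ ≤ C) : ‖f t - f 0‖ ≤ C * |t| := by
  have := (convex_closedBall (0 : ℝ) |t|).norm_image_sub_le_of_norm_hasDerivWithin_le
    (f := f) (f' := f') (C := C) (x := 0) (y := t) (fun r _ => (hf r).hasDerivWithinAt)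
    (fun r hr => hC r (by simpa using hr)) (by simp) (by simp)
  simpa using this

variable {H : Type*} [NormedAddCommGroup H] [InnerProductSpace ℂ H] [CompleteSpace H]

lemma inner_apply_eq_neg {A : H →L[ℂ] H} (hA : A ∈ skewAdjoint (H →L[ℂ] H)) (x y : H) :
    inner ℂ (A x) y = -inner ℂ x (A y) := by
  rw [skewAdjoint.mem_iff, ContinuousLinearMap.star_eq_adjoint] at hA
  rw [← ContinuousLinearMap.adjoint_inner_right, hA]
  simp

lemma re_inner_apply_self_eq_zero {A : H →L[ℂ] H} (hA : A ∈ skewAdjoint (H →L[ℂ] H)) (x : H) :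
    (inner ℂ x (A x)).re = 0 := by
  have h := inner_apply_eq_neg hA x x
  have h2 := inner_conj_symm (𝕜 := ℂ) x (A x)
  have h3 := congrArg Complex.re h2
  rw [h] at h3
  have h4 := congrArg Complex.re (inner_conj_symm (𝕜 := ℂ) (A x) x)
  rw [h] at h4
  simp only [Complex.conj_re, Complex.neg_re] at h3 h4
  linarith

lemma real_smul_mem_skewAdjoint {A : H →L[ℂ] H} (hA : A ∈ skewAdjoint (H →L[ℂ] H)) (t : ℝ) :
    t • A ∈ skewAdjoint (H →L[ℂ] H) :=
  skewAdjoint.smul_mem t hA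

lemma exp_mem_unitary {A : H →L[ℂ] H} (hA : A ∈ skewAdjoint (H →L[ℂ] H)) (t : ℝ) :
    NormedSpace.exp (t • A) ∈ unitary (H →L[ℂ] H) :=
  let _ : NormedAlgebra ℚ (H →L[ℂ] H) := NormedAlgebra.restrictScalars ℚ ℂ _
  NormedSpace.exp_mem_unitary_of_mem_skewAdjoint (real_smul_mem_skewAdjoint hA t)

lemma norm_apply_of_mem_unitary {U : H →L[ℂ] H} (hU : U ∈ unitary (H →L[ℂ] H)) (x : H) :
    ‖U x‖ = ‖x‖ :=
  (ContinuousLinearMap.norm_map_iff_adjoint_comp_self U).mpr (Unitary.star_mul_self_of_mem hU) x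

lemma norm_exp_apply {A : H →L[ℂ] H} (hA : A ∈ skewAdjoint (H →L[ℂ] H)) (t : ℝ) (x : H) :
    ‖NormedSpace.exp (t • A) x‖ = ‖x‖ :=
  norm_apply_of_mem_unitary (exp_mem_unitary hA t) x

lemma exp_add_smul (A : H →L[ℂ] H) (s t : ℝ) :
    NormedSpace.exp ((s + t) • A) = NormedSpace.exp (s • A) * NormedSpace.exp (t • A) := by
  let _ : NormedAlgebra ℚ (H →L[ℂ] H) := NormedAlgebra.restrictScalars ℚ ℂ _
  rw [add_smul]
  exact NormedSpace.exp_add_of_commute (((Commute.refl A).smul_left s).smul_right t)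

lemma hasDerivAt_exp_apply (A : H →L[ℂ] H) (x : H) (t : ℝ) :
    HasDerivAt (fun t : ℝ => NormedSpace.exp (t • A) x) (NormedSpace.exp (t • A) (A x)) t := by
  have h := hasDerivAt_exp_smul_const A t
  exact (((ContinuousLinearMap.apply ℂ H x).restrictScalars ℝ).hasFDerivAt.comp_hasDerivAt t h)

lemma hasDerivAt_exp_apply' (A : H →L[ℂ] H) (x : H) (t : ℝ) :
    HasDerivAt (fun t : ℝ => NormedSpace.exp (t • A) x) (A (NormedSpace.exp (t • A) x)) t := by
  have h := hasDerivAt_exp_smul_const' A t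
  exact (((ContinuousLinearMap.apply ℂ H x).restrictScalars ℝ).hasFDerivAt.comp_hasDerivAt t h)

lemma norm_exp_apply_sub_le {A : H →L[ℂ] H} (hA : A ∈ skewAdjoint (H →L[ℂ] H)) (t : ℝ) (x : H) :
    ‖NormedSpace.exp (t • A) x - x‖ ≤ |t| * ‖A x‖ := by
  have := norm_sub_le_of_hasDerivAt (t := t) (C := ‖A x‖) (hasDerivAt_exp_apply A x)
    (fun r _ => (norm_exp_apply hA r _).le)
  simpa [mul_comm] using this

/-- A first-order Taylor bound for `e^{tA}x` in which `A` is applied only to `x` and to an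
auxiliary vector `y` near `A x`. It involves no second power of `A`, hence survives a passage to
strong limits. -/
lemma norm_exp_apply_sub_sub_le {A : H →L[ℂ] H} (hA : A ∈ skewAdjoint (H →L[ℂ] H)) (t : ℝ)
    (x y : H) :
    ‖NormedSpace.exp (t • A) x - x - t • A x‖ ≤ |t| * (2 * ‖A x - y‖ + |t| * ‖A y‖) := by
  have hd : ∀ r : ℝ, HasDerivAt (fun r : ℝ => NormedSpace.exp (r • A) x - r • A x)
      (NormedSpace.exp (r • A) (A x) - A x) r := by
    intro r
    refine (hasDerivAt_exp_apply A x r).sub ?_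
    simpa using (hasDerivAt_id r).smul_const (A x)
  have := norm_sub_le_of_hasDerivAt (t := t) (C := 2 * ‖A x - y‖ + |t| * ‖A y‖) hd ?_
  · simpa [mul_comm, sub_right_comm] using this
  intro r hr
  have e : NormedSpace.exp (r • A) (A x) - A x
      = NormedSpace.exp (r • A) (A x - y) - (A x - y) + (NormedSpace.exp (r • A) y - y) := by
    rw [map_sub]; abel
  rw [e]
  refine (norm_add_le _ _).trans (add_le_add ((norm_sub_le _ _).trans ?_) ?_)
  · rw [norm_exp_apply hA]; linarith
  · exact (norm_exp_apply_sub_le hA r y).trans (by gcongr)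

/-- The bounded operator `(1 - s A)⁻¹` (and `0` if the inverse does not exist, which does not occur
for skew-adjoint `A`). -/
noncomputable def resolventAt (A : H →L[ℂ] H) (s : ℝ) : H →L[ℂ] H := Ring.inverse (1 - s • A)

lemma isUnit_one_sub_smul {A : H →L[ℂ] H} (hA : A ∈ skewAdjoint (H →L[ℂ] H)) (s : ℝ) :
    IsUnit (1 - s • A) := by
  refine ContinuousLinearMap.isUnit_of_forall_le_norm_inner_map _ (c := 1) one_pos fun x => ?_
  have h : (inner ℂ ((1 - s • A) x) x).re = ‖x‖ ^ 2 := by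
    have h1 := re_inner_apply_self_eq_zero (real_smul_mem_skewAdjoint hA s) x
    have h2 := inner_apply_eq_neg (real_smul_mem_skewAdjoint hA s) x x
    rw [sub_apply, inner_sub_left, Complex.sub_re, h2, Complex.neg_re, h1]
    simp [inner_self_eq_norm_sq_to_K, ← Complex.ofReal_pow]
  calc ‖x‖ ^ 2 * ((1 : NNReal) : ℝ) = (inner ℂ ((1 - s • A) x) x).re := by rw [h]; simp
    _ ≤ _ := Complex.re_le_norm _

lemma resolventAt_apply_sub {A : H →L[ℂ] H} (hA : A ∈ skewAdjoint (H →L[ℂ] H)) (s : ℝ) (x : H) :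
    resolventAt A s (x - s • A x) = x := by
  have := congrArg (fun B : H →L[ℂ] H => B x) (Ring.inverse_mul_cancel _ (isUnit_one_sub_smul hA s))
  simpa [resolventAt] using this

lemma sub_resolventAt_apply {A : H →L[ℂ] H} (hA : A ∈ skewAdjoint (H →L[ℂ] H)) (s : ℝ) (x : H) :
    resolventAt A s x - s • A (resolventAt A s x) = x := by
  have := congrArg (fun B : H →L[ℂ] H => B x) (Ring.mul_inverse_cancel _ (isUnit_one_sub_smul hA s))
  simpa [resolventAt] using this

lemma norm_resolventAt_apply_le {A : H →L[ℂ] H} (hA : A ∈ skewAdjoint (H →L[ℂ] H)) (s : ℝ)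
    (x : H) : ‖resolventAt A s x‖ ≤ ‖x‖ := by
  set y := resolventAt A s x with hy
  have hx : y - s • A y = x := sub_resolventAt_apply hA s x
  have h1 := re_inner_apply_self_eq_zero (real_smul_mem_skewAdjoint hA s) y
  have h2 : ‖y‖ ^ 2 = (inner ℂ y x).re := by
    rw [← hx, inner_sub_right, Complex.sub_re, ← smul_apply, h1]
    simp [inner_self_eq_norm_sq_to_K, ← Complex.ofReal_pow]
  have h3 : (inner ℂ y x).re ≤ ‖y‖ * ‖x‖ := (Complex.re_le_norm _).trans (norm_inner_le_norm _ _)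
  rcases eq_or_ne ‖y‖ 0 with h | h
  · rw [h]; positivity
  · have : 0 < ‖y‖ := lt_of_le_of_ne (norm_nonneg _) (Ne.symm h)
    nlinarith

lemma apply_resolventAt {A : H →L[ℂ] H} (hA : A ∈ skewAdjoint (H →L[ℂ] H)) (s : ℝ) (x : H) :
    A (resolventAt A s x) = resolventAt A s (A x) := by
  have h := resolventAt_apply_sub hA s (A (resolventAt A s x))
  rw [← ContinuousLinearMap.map_smul_of_tower A, ← map_sub, sub_resolventAt_apply hA] at h
  exact h.symm

/-- The error of one implicit Euler step, from `e^{sA}x - (1 - sA)⁻¹x = (1 - sA)⁻¹(f s - f 0)` with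
`f r = (1 - rA) e^{rA} x`. -/
lemma norm_exp_apply_sub_resolventAt_le {A : H →L[ℂ] H} (hA : A ∈ skewAdjoint (H →L[ℂ] H)) (s : ℝ)
    (x : H) : ‖NormedSpace.exp (s • A) x - resolventAt A s x‖ ≤ s ^ 2 * ‖A (A x)‖ := by
  set f : ℝ → H := fun r => NormedSpace.exp (r • A) x - r • A (NormedSpace.exp (r • A) x) with hf
  have hcomm : ∀ r y, A (NormedSpace.exp (r • A) y) = NormedSpace.exp (r • A) (A y) := fun r y =>
    (hasDerivAt_exp_apply' A y r).unique (hasDerivAt_exp_apply A y r)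
  have hd : ∀ r : ℝ, HasDerivAt f (-(r • NormedSpace.exp (r • A) (A (A x)))) r := by
    intro r
    have h1 := hasDerivAt_exp_apply A x r
    have h2 := (hasDerivAt_id r).smul (hasDerivAt_exp_apply A (A x) r)
    have h3 := h1.sub h2
    have e : f = fun r : ℝ => NormedSpace.exp (r • A) x - r • NormedSpace.exp (r • A) (A x) := by
      funext r; simp only [hf, hcomm]
    rw [e]
    refine h3.congr_deriv ?_
    simp only [id]
    module
  have h := norm_sub_le_of_hasDerivAt (t := s) (C := |s| * ‖A (A x)‖) hd ?_
  · have e : NormedSpace.exp (s • A) x - resolventAt A s x = resolventAt A s (f s - f 0) := by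
      have h0 : f 0 = x := by simp [hf]
      rw [h0, map_sub]
      congr 1
      exact (resolventAt_apply_sub hA s _).symm
    rw [e]
    refine (norm_resolventAt_apply_le hA s _).trans (h.trans_eq ?_)
    rw [← sq_abs]; ring
  · intro r hr
    rw [norm_neg, norm_smul, norm_exp_apply hA, Real.norm_eq_abs]
    gcongr

/-- The error of the implicit Euler scheme for `e^{tA}`, with `j` steps of size `s`. -/
lemma norm_exp_apply_sub_resolventAt_pow_le {A : H →L[ℂ] H} (hA : A ∈ skewAdjoint (H →L[ℂ] H))
    (s : ℝ) (j : ℕ) (x : H) :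
    ‖NormedSpace.exp ((j * s) • A) x - (resolventAt A s ^ j) x‖ ≤ j * (s ^ 2 * ‖A (A x)‖) := by
  induction j generalizing x with
  | zero => simp
  | succ j ih =>
    have e : NormedSpace.exp (((j + 1 : ℕ) * s) • A) x - (resolventAt A s ^ (j + 1)) x
        = NormedSpace.exp ((j * s) • A) (NormedSpace.exp (s • A) x - resolventAt A s x)
          + (NormedSpace.exp ((j * s) • A) (resolventAt A s x)
            - (resolventAt A s ^ j) (resolventAt A s x)) := by
      have : ((j + 1 : ℕ) : ℝ) * s = j * s + s := by push_cast; ring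
      rw [this, exp_add_smul, pow_succ, map_sub, mul_apply_eq_comp,
        mul_apply_eq_comp]
      abel
    rw [e]
    refine (norm_add_le _ _).trans ?_
    rw [norm_exp_apply hA]
    have h1 := norm_exp_apply_sub_resolventAt_le hA s x
    have h2 := ih (resolventAt A s x)
    rw [apply_resolventAt hA, apply_resolventAt hA] at h2
    have h3 : (j : ℝ) * (s ^ 2 * ‖resolventAt A s (A (A x))‖) ≤ j * (s ^ 2 * ‖A (A x)‖) := by
      gcongr; exact norm_resolventAt_apply_le hA s _
    rw [Nat.cast_succ]
    linarith

lemma norm_apply_resolventAt_one_le {A : H →L[ℂ] H} (hA : A ∈ skewAdjoint (H →L[ℂ] H)) (x : H) :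
    ‖A (resolventAt A 1 x)‖ ≤ 2 * ‖x‖ := by
  have h := sub_resolventAt_apply hA 1 x
  rw [one_smul] at h
  have : A (resolventAt A 1 x) = resolventAt A 1 x - x :=
    eq_sub_of_add_eq' (by nth_rewrite 1 [← h]; abel)
  rw [this]
  refine (norm_sub_le _ _).trans ?_
  linarith [norm_resolventAt_apply_le hA 1 x]

end Bounded

/-! ### Strong limits -/

section Limits

/-- In a complete space, a uniform limit of convergent families converges. -/
lemma exists_tendsto_of_approx {H : Type*} [NormedAddCommGroup H] [CompleteSpace H]
    {ι : Type*} {l : Filter ι} [l.NeBot] {u : ι → H}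
    (h : ∀ ε > 0, ∃ f : ι → H, (∃ y, Tendsto f l (𝓝 y)) ∧ ∀ᶠ i in l, dist (u i) (f i) ≤ ε) :
    ∃ y, Tendsto u l (𝓝 y) := by
  refine CompleteSpace.complete (f := map u l) (Metric.cauchy_iff.mpr ⟨inferInstance, ?_⟩)
  intro ε hε
  obtain ⟨f, ⟨y, hy⟩, hf⟩ := h (ε / 5) (by positivity)
  have hy' := (Metric.tendsto_nhds.mp hy) (ε / 5) (by positivity)
  refine ⟨u '' {i | dist (u i) (f i) ≤ ε / 5 ∧ dist (f i) y < ε / 5},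
    image_mem_map (hf.and hy'), ?_⟩
  rintro _ ⟨i, ⟨hi1, hi2⟩, rfl⟩ _ ⟨j, ⟨hj1, hj2⟩, rfl⟩
  have h1 := dist_triangle (u i) (f i) y
  have h2 := dist_triangle (u j) (f j) y
  have h3 := dist_triangle_right (u i) (u j) y
  linarith

lemma tendsto_apply_of_contraction {H : Type*} [NormedAddCommGroup H] [InnerProductSpace ℂ H]
    {ι : Type*} {l : Filter ι} {B : ι → H →L[ℂ] H} (hB : ∀ i x, ‖B i x‖ ≤ ‖x‖) {u : ι → H}
    {y z : H} (hu : Tendsto u l (𝓝 y)) (hy : Tendsto (fun i => B i y) l (𝓝 z)) :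
    Tendsto (fun i => B i (u i)) l (𝓝 z) := by
  have h : Tendsto (fun i => B i (u i) - B i y) l (𝓝 0) := by
    refine squeeze_zero_norm (a := fun i => ‖u i - y‖) (fun i => ?_) ?_
    · rw [← map_sub]; exact hB _ _
    · simpa using (hu.sub_const y).norm
  simpa using h.add hy

end Limits

/-! ### Skew-symmetric operators and their closures -/

section SkewSymmetric

variable {H : Type*} [NormedAddCommGroup H] [InnerProductSpace ℂ H]

/-- `T` is skew-symmetric: `⟪T x, y⟫ = -⟪x, T y⟫` on the domain of `T`. -/
def IsSkewSymmetric (T : H →ₗ.[ℂ] H) : Prop :=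
  ∀ x y : T.domain, inner ℂ (T x) (y : H) = -inner ℂ (x : H) (T y)

/-- An operator with a densely defined formal adjoint is closable. -/
lemma isClosable_of_isFormalAdjoint {T S : H →ₗ.[ℂ] H} (h : T.IsFormalAdjoint S)
    (hS : Dense (S.domain : Set H)) : T.IsClosable := by
  refine ⟨T.graph.topologicalClosure.toLinearPMap,
    (Submodule.toLinearPMap_graph_eq _ ?_).symm⟩
  rintro ⟨x, y⟩ hp (rfl : x = 0)
  have key : ∀ z : S.domain, ∀ p ∈ T.graph.topologicalClosure,
      inner ℂ p.2 (z : H) = inner ℂ p.1 (S z) := by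
    intro z p hp
    refine closure_minimal (s := (T.graph : Set (H × H)))
      (t := {p | inner ℂ p.2 (z : H) = inner ℂ p.1 (S z)}) ?_
      (isClosed_eq (by fun_prop) (by fun_prop)) hp
    rintro ⟨a, b⟩ hab
    obtain ⟨a', rfl, rfl⟩ := (LinearPMap.mem_graph_iff T).mp hab
    exact h a' z
  refine hS.eq_zero_of_inner_left ℂ fun z hz => ?_
  simpa using key ⟨z, hz⟩ _ hp

lemma mem_closure_graph_iff {T : H →ₗ.[ℂ] H} (hT : T.IsClosable) {p : H × H} :
    p ∈ T.closure.graph ↔ p ∈ closure (T.graph : Set (H × H)) := by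
  rw [← hT.graph_closure_eq_closure_graph, ← SetLike.mem_coe, Submodule.topologicalClosure_coe]

variable {T : H →ₗ.[ℂ] H}

lemma IsSkewSymmetric.isClosable (h : IsSkewSymmetric T) (hT : Dense (T.domain : Set H)) :
    T.IsClosable :=
  isClosable_of_isFormalAdjoint (S := -T)
    (fun x y => by simpa using h x y) (by simpa using hT)

lemma IsSkewSymmetric.inner_closure (h : IsSkewSymmetric T) (hT : Dense (T.domain : Set H))
    {p q : H × H} (hp : p ∈ T.closure.graph) (hq : q ∈ T.closure.graph) :
    inner ℂ p.2 q.1 = -inner ℂ p.1 q.2 := by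
  rw [mem_closure_graph_iff (h.isClosable hT)] at hp hq
  have h1 : ∀ q ∈ (T.graph : Set (H × H)), ∀ p ∈ closure (T.graph : Set (H × H)),
      inner ℂ p.2 q.1 = -inner ℂ p.1 q.2 := by
    intro q hq p hp
    refine closure_minimal (t := {p | inner ℂ p.2 q.1 = -inner ℂ p.1 q.2}) ?_
      (isClosed_eq (by fun_prop) (by fun_prop)) hp
    rintro ⟨a, b⟩ hab
    obtain ⟨a', rfl, rfl⟩ := (LinearPMap.mem_graph_iff T).mp hab
    obtain ⟨c', hc, hd⟩ := (LinearPMap.mem_graph_iff T).mp hq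
    change inner ℂ (T a') q.1 = -inner ℂ (a' : H) q.2
    rw [← hc, ← hd]
    exact h a' c'
  exact closure_minimal (t := {q : H × H | inner ℂ p.2 q.1 = -inner ℂ p.1 q.2})
    (fun q hq => h1 q hq p hp) (isClosed_eq (by fun_prop) (by fun_prop)) hq

lemma IsSkewSymmetric.re_inner_closure (h : IsSkewSymmetric T) (hT : Dense (T.domain : Set H))
    {p : H × H} (hp : p ∈ T.closure.graph) : (inner ℂ p.1 p.2).re = 0 := by
  have h1 := congrArg Complex.re (h.inner_closure hT hp hp)
  have h2 := congrArg Complex.re (inner_conj_symm (𝕜 := ℂ) p.1 p.2)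
  simp only [Complex.conj_re, Complex.neg_re] at h1 h2
  linarith

/-- Applied to `y = T x` for a skew-symmetric `T`: the graph norm is controlled by `1 - s T`. -/
lemma norm_sub_smul_sq {x y : H} (h : (inner ℂ x y).re = 0) (s : ℝ) :
    ‖x - s • y‖ ^ 2 = ‖x‖ ^ 2 + s ^ 2 * ‖y‖ ^ 2 := by
  have e : s • y = (s : ℂ) • y := (Complex.coe_smul s y).symm
  have := norm_sub_sq (𝕜 := ℂ) x (s • y)
  rw [this, e, inner_smul_right, norm_smul, Complex.norm_real, mul_pow, Real.norm_eq_abs, sq_abs]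
  simp [h]

/-- If `1 - s T` has dense range, for a skew-symmetric `T` and `s ≠ 0`, then `1 - s T̄` is
surjective, since its range is closed. -/
lemma IsSkewSymmetric.exists_sub_smul_eq [CompleteSpace H] (h : IsSkewSymmetric T)
    (hT : Dense (T.domain : Set H)) {s : ℝ} (hs : s ≠ 0)
    (hran : Dense (Set.range fun ψ : T.domain => (ψ : H) - s • T ψ)) (z : H) :
    ∃ p ∈ T.closure.graph, p.1 - s • p.2 = z := by
  have hcl : IsClosed (T.closure.graph : Set (H × H)) := (h.isClosable hT).closure_isClosed
  have : CompleteSpace T.closure.graph := hcl.completeSpace_coe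
  let f : T.closure.graph →ₗ[ℝ] H :=
    { toFun := fun p => p.1.1 - s • p.1.2
      map_add' := fun p q => by simp only [Submodule.coe_add, Prod.fst_add, Prod.snd_add]; module
      map_smul' := fun c p => by
        change c • p.1.1 - s • c • p.1.2 = c • (p.1.1 - s • p.1.2)
        module }
  have hf : Continuous f := by
    change Continuous fun p : T.closure.graph => p.1.1 - s • p.1.2
    fun_prop
  -- `1 - s T̄` is bounded below on the graph of `T̄`, which is complete
  have hbd : ∀ p : T.closure.graph, ‖p‖ ≤ (1 + |s|⁻¹) * ‖f p‖ := by
    intro p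
    have h1 : ‖f p‖ ^ 2 = ‖p.1.1‖ ^ 2 + s ^ 2 * ‖p.1.2‖ ^ 2 :=
      norm_sub_smul_sq (h.re_inner_closure hT p.2) s
    have h2 : ‖p.1.1‖ ≤ ‖f p‖ := abs_le_of_sq_le_sq'
      (by rw [h1]; nlinarith [sq_nonneg (s * ‖p.1.2‖)]) (norm_nonneg _) |>.2
    have h3 : |s| * ‖p.1.2‖ ≤ ‖f p‖ := abs_le_of_sq_le_sq'
      (by rw [h1, mul_pow, sq_abs]; nlinarith [sq_nonneg (‖p.1.1‖)]) (norm_nonneg _) |>.2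
    have hs' : 0 < |s| := abs_pos.mpr hs
    have h4 : ‖p.1.2‖ ≤ |s|⁻¹ * ‖f p‖ := by
      rw [inv_mul_eq_div, le_div_iff₀ hs']; linarith
    have h5 : 0 ≤ |s|⁻¹ * ‖f p‖ := by positivity
    change max ‖p.1.1‖ ‖p.1.2‖ ≤ _
    rw [add_mul, one_mul]
    exact max_le (by linarith) (by linarith [norm_nonneg (f p)])
  have hanti : AntilipschitzWith (⟨1 + |s|⁻¹, by positivity⟩ : NNReal) f :=
    AddMonoidHomClass.antilipschitz_of_bound f hbd
  have hunif : UniformContinuous f := (⟨f, hf⟩ : T.closure.graph →L[ℝ] H).uniformContinuous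
  have hclosed := hanti.isClosed_range hunif
  have hdense : Dense (Set.range f) := hran.mono (by
    rintro _ ⟨ψ, rfl⟩
    exact ⟨⟨((ψ : H), T ψ), LinearPMap.le_graph_of_le T.le_closure (T.mem_graph ψ)⟩, rfl⟩)
  obtain ⟨p, hp⟩ := (hclosed.closure_eq ▸ hdense.closure_eq ▸ Set.mem_univ z : z ∈ Set.range f)
  exact ⟨p.1, p.2, hp⟩

/-- The basic criterion for essential skew-adjointness: a skew-symmetric operator `T` for which the
operators `1 - s T`, `s` real, have dense range is essentially skew-adjoint. -/
theorem IsSkewSymmetric.isEssentiallySkewAdjoint [CompleteSpace H] (h : IsSkewSymmetric T)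
    (hT : Dense (T.domain : Set H))
    (hran : ∀ s : ℝ, Dense (Set.range fun ψ : T.domain => (ψ : H) - s • T ψ)) :
    IsEssentiallySkewAdjoint T := by
  set S := Complex.I • T with hS
  have hsymm : S.IsFormalAdjoint S := fun x y => by
    change inner ℂ (Complex.I • T x) (y : H) = inner ℂ (x : H) (Complex.I • T y)
    rw [inner_smul_left, inner_smul_right, h x y]
    simp
  have hclS : S.IsClosable := isClosable_of_isFormalAdjoint hsymm hT
  have hdense : Dense (S.closure.domain : Set H) := hT.mono S.le_closure.1
  have hgraph : ∀ p : H × H, p ∈ S.closure.graph ↔ (p.1, -Complex.I • p.2) ∈ T.closure.graph := by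
    intro p
    rw [mem_closure_graph_iff hclS, mem_closure_graph_iff (h.isClosable hT)]
    constructor
    · intro hp
      refine map_mem_closure (f := fun p : H × H => (p.1, -Complex.I • p.2)) (by fun_prop) hp ?_
      rintro ⟨a, b⟩ hab
      obtain ⟨a', rfl, rfl⟩ := (LinearPMap.mem_graph_iff S).mp hab
      refine (LinearPMap.mem_graph_iff T).mpr ⟨a', rfl, ?_⟩
      change T a' = -Complex.I • Complex.I • T a'
      simp [smul_smul]
    · intro hp
      have := map_mem_closure (f := fun p : H × H => (p.1, Complex.I • p.2)) (t := S.graph)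
        (by fun_prop) hp ?_
      · simpa [smul_smul] using this
      rintro ⟨a, b⟩ hab
      obtain ⟨a', rfl, rfl⟩ := (LinearPMap.mem_graph_iff T).mp hab
      exact (LinearPMap.mem_graph_iff S).mpr ⟨a', rfl, rfl⟩
  have hsurj : ∀ s : ℝ, s ≠ 0 → ∀ z : H, ∃ x : S.closure.domain,
      (x : H) + (s * Complex.I) • S.closure x = z := by
    intro s hs z
    obtain ⟨p, hp, hz⟩ := h.exists_sub_smul_eq hT hs (hran s) z
    have hp' : (p.1, Complex.I • p.2) ∈ S.closure.graph := by
      rw [hgraph]; simpa [smul_smul] using hp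
    obtain ⟨x, hx1, hx2⟩ := (LinearPMap.mem_graph_iff _).mp hp'
    refine ⟨x, ?_⟩
    simp only at hx1 hx2
    rw [hx1, hx2, smul_smul, mul_assoc, Complex.I_mul_I, ← hz, mul_neg_one, neg_smul,
      Complex.coe_smul, sub_eq_add_neg]
  have hsymm' : S.closure.IsFormalAdjoint S.closure := by
    intro x y
    have h1 := h.inner_closure hT ((hgraph _).mp (S.closure.mem_graph x))
      ((hgraph _).mp (S.closure.mem_graph y))
    simp only [inner_smul_left, inner_smul_right] at h1
    have hI := Complex.I_ne_zero
    simp at h1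
    exact h1
  have hle : S.closure ≤ S.closure.adjoint := hsymm'.le_adjoint hdense
  rw [IsEssentiallySkewAdjoint, LinearPMap.isSelfAdjoint_def]
  refine (LinearPMap.eq_of_le_of_domain_eq hle (le_antisymm hle.1 fun x hx => ?_)).symm
  -- for `x` in the domain of the adjoint, solve `(1 + i S̄) u = (1 + i S*) x`; then `x - u` is
  -- orthogonal to the range of `1 - i S̄`, which is everything
  obtain ⟨u, hu⟩ := hsurj 1 one_ne_zero (x + Complex.I • S.closure.adjoint ⟨x, hx⟩)
  have hform := S.closure.adjoint_isFormalAdjoint hdense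
  suffices hxu : x - u = 0 by
    rw [sub_eq_zero.mp hxu]; exact u.2
  obtain ⟨v, hv⟩ := hsurj (-1) (by norm_num) (x - u)
  have h1 := hform ⟨x, hx⟩ v
  have h2 := hsymm' u v
  rw [← inner_self_eq_zero (𝕜 := ℂ)]
  nth_rewrite 2 [← hv]
  have hu' : x - u = -(Complex.I • (S.closure.adjoint ⟨x, hx⟩ - S.closure u)) := by
    simp only [Complex.ofReal_one, one_mul] at hu
    rw [smul_sub]
    linear_combination (norm := module) (-1 : ℂ) • hu
  rw [inner_add_right, inner_smul_right, inner_sub_left x (u : H) (S.closure v)]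
  simp only at h1
  rw [← h1, ← h2, hu', inner_neg_left, inner_smul_left, inner_sub_left]
  simp

end SkewSymmetric

/-! ### Unitary groups as strong limits of bounded exponentials -/

section Generation

variable {H : Type*} [NormedAddCommGroup H] [InnerProductSpace ℂ H] [CompleteSpace H]

lemma IsUnitaryGroupGeneratedBy.hasDerivAt {U : ℝ → H →L[ℂ] H} {T : H →ₗ.[ℂ] H}
    (hU : IsUnitaryGroupGeneratedBy U T) {p : H × H} (hp : p ∈ T.closure.graph) (t : ℝ) :
    HasDerivAt (fun t => U t p.1) (U t p.2) t := by
  have h0 : HasDerivAt (fun t => U t p.1) p.2 (t - t) := by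
    rw [sub_self]; exact (hU.generator p.1 p.2).mp hp
  have h1 := h0.comp_sub_const t t
  have h2 := ((U t).restrictScalars ℝ).hasFDerivAt.comp_hasDerivAt t h1
  refine h2.congr_of_eventuallyEq (Eventually.of_forall fun r => ?_)
  change U r p.1 = (U t * U (r - t)) p.1
  rw [← hU.map_add]
  simp

lemma IsUnitaryGroupGeneratedBy.map_mem_graph {U : ℝ → H →L[ℂ] H} {T : H →ₗ.[ℂ] H}
    (hU : IsUnitaryGroupGeneratedBy U T) {p : H × H} (hp : p ∈ T.closure.graph) (t : ℝ) :
    (U t p.1, U t p.2) ∈ T.closure.graph := by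
  rw [hU.generator]
  have h2 := ((U t).restrictScalars ℝ).hasFDerivAt.comp_hasDerivAt 0
    ((hU.generator p.1 p.2).mp hp)
  refine h2.congr_of_eventuallyEq (Eventually.of_forall fun r => ?_)
  change (U r * U t) p.1 = (U t * U r) p.1
  rw [← hU.map_add, ← hU.map_add, add_comm]

/-- A skew-symmetric operator generates at most one unitary group: the difference `v` of two
orbits of a vector of the domain satisfies `v' = T̄ v`, so that `‖v‖` is constant. -/
theorem IsUnitaryGroupGeneratedBy.unique {U W : ℝ → H →L[ℂ] H} {T : H →ₗ.[ℂ] H}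
    (hU : IsUnitaryGroupGeneratedBy U T) (h : IsSkewSymmetric T)
    (hT : Dense (T.domain : Set H)) (hW : IsUnitaryGroupGeneratedBy W T) : U = W := by
  funext t
  refine ContinuousLinearMap.coeFn_injective
    ((U t).continuous.ext_on hT (W t).continuous fun x hx => ?_)
  set y := T ⟨x, hx⟩
  have hp : (x, y) ∈ T.closure.graph := LinearPMap.le_graph_of_le T.le_closure (T.mem_graph ⟨x, hx⟩)
  let _ : InnerProductSpace ℝ H := InnerProductSpace.rclikeToReal ℂ H
  have hd : ∀ t, HasDerivAt (fun t => ‖U t x - W t x‖ ^ 2) 0 t := by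
    intro t
    have h1 := ((hU.hasDerivAt hp t).sub (hW.hasDerivAt hp t)).norm_sq
    refine h1.congr_deriv ?_
    have h2 := h.re_inner_closure hT (sub_mem (hU.map_mem_graph hp t) (hW.map_mem_graph hp t))
    rw [real_inner_eq_re_inner ℂ]
    simpa [inner_sub_left, inner_sub_right] using h2
  have hconst := is_const_of_deriv_eq_zero (fun t => (hd t).differentiableAt)
    (fun t => (hd t).deriv) t 0
  simp only [hU.map_zero, hW.map_zero, sub_self, norm_zero] at hconst
  simpa [sub_eq_zero] using hconst

lemma unitaryExp_eq {U : ℝ → H →L[ℂ] H} {T : H →ₗ.[ℂ] H}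
    (h : IsSkewSymmetric T) (hT : Dense (T.domain : Set H))
    (hU : IsUnitaryGroupGeneratedBy U T) : unitaryExp T = U := by
  have hex : ∃ U, IsUnitaryGroupGeneratedBy U T := ⟨U, hU⟩
  rw [unitaryExp, dif_pos hex]
  exact hex.choose_spec.unique h hT hU

variable {ι : Type*} {l : Filter ι} {A : ι → H →L[ℂ] H} {T : H →ₗ.[ℂ] H}

lemma isSkewSymmetric_of_tendsto [l.NeBot] (hA : ∀ i, A i ∈ skewAdjoint (H →L[ℂ] H))
    (hlim : ∀ ψ : T.domain, Tendsto (fun i => A i ψ) l (𝓝 (T ψ))) : IsSkewSymmetric T := by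
  intro x y
  have h1 : Tendsto (fun i => inner ℂ (A i x) (y : H)) l (𝓝 (inner ℂ (T x) (y : H))) :=
    (hlim x).inner tendsto_const_nhds
  have h2 : Tendsto (fun i => -inner ℂ (x : H) (A i y)) l (𝓝 (-inner ℂ (x : H) (T y))) :=
    (tendsto_const_nhds.inner (hlim y)).neg
  refine tendsto_nhds_unique h1 (h2.congr fun i => ?_)
  rw [inner_apply_eq_neg (hA i)]

/-- The resolvents converge strongly on the range of `1 - s T`, since
`(1 - s A_i)⁻¹ (ψ - s T ψ) - ψ = s (1 - s A_i)⁻¹ (A_i ψ - T ψ)`. -/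
lemma tendsto_resolventAt (hA : ∀ i, A i ∈ skewAdjoint (H →L[ℂ] H))
    (hlim : ∀ ψ : T.domain, Tendsto (fun i => A i ψ) l (𝓝 (T ψ))) (s : ℝ) (ψ : T.domain) :
    Tendsto (fun i => resolventAt (A i) s ((ψ : H) - s • T ψ)) l (𝓝 ψ) := by
  have h : Tendsto (fun i => resolventAt (A i) s ((ψ : H) - s • T ψ) - ψ) l (𝓝 0) := by
    refine squeeze_zero_norm (a := fun i => |s| * ‖A i ψ - T ψ‖) (fun i => ?_) ?_
    · have e : resolventAt (A i) s ((ψ : H) - s • T ψ) - ψ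
          = resolventAt (A i) s (s • (A i ψ - T ψ)) := by
        nth_rewrite 2 [← resolventAt_apply_sub (hA i) s (ψ : H)]
        rw [← map_sub]
        congr 1
        module
      rw [e]
      refine (norm_resolventAt_apply_le (hA i) s _).trans_eq ?_
      rw [norm_smul, Real.norm_eq_abs]
    · simpa using (((hlim ψ).sub_const (T ψ)).norm.const_mul |s|)
  simpa using h.add_const (ψ : H)

lemma exists_tendsto_resolventAt [l.NeBot] (hA : ∀ i, A i ∈ skewAdjoint (H →L[ℂ] H))
    (hlim : ∀ ψ : T.domain, Tendsto (fun i => A i ψ) l (𝓝 (T ψ))) {s : ℝ}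
    (hran : Dense (Set.range fun ψ : T.domain => (ψ : H) - s • T ψ)) (x : H) :
    ∃ y, Tendsto (fun i => resolventAt (A i) s x) l (𝓝 y) := by
  refine exists_tendsto_of_approx fun ε hε => ?_
  obtain ⟨_, ⟨ψ, rfl⟩, hψ⟩ := hran.exists_dist_lt x hε
  refine ⟨_, ⟨ψ, tendsto_resolventAt hA hlim s ψ⟩, Eventually.of_forall fun i => ?_⟩
  rw [dist_eq_norm, ← map_sub]
  refine (norm_resolventAt_apply_le (hA i) s _).trans ?_
  rw [← dist_eq_norm]
  exact hψ.le

lemma exists_tendsto_resolventAt_pow [l.NeBot] (hA : ∀ i, A i ∈ skewAdjoint (H →L[ℂ] H))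
    (hlim : ∀ ψ : T.domain, Tendsto (fun i => A i ψ) l (𝓝 (T ψ))) {s : ℝ}
    (hran : Dense (Set.range fun ψ : T.domain => (ψ : H) - s • T ψ)) (k : ℕ) (x : H) :
    ∃ y, Tendsto (fun i => (resolventAt (A i) s ^ k) x) l (𝓝 y) := by
  induction k with
  | zero => exact ⟨x, by simp⟩
  | succ k ih =>
    obtain ⟨y, hy⟩ := ih
    obtain ⟨z, hz⟩ := exists_tendsto_resolventAt hA hlim hran y
    refine ⟨z, (tendsto_apply_of_contraction
      (fun i => norm_resolventAt_apply_le (hA i) s) hy hz).congr fun i => ?_⟩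
    rw [pow_succ', mul_apply_eq_comp]

/-- Strong convergence of the exponentials: up to a small error a vector `x` is of the form
`(1 - A_i)⁻² w`; on such vectors the implicit Euler scheme converges to `e^{tA_i}` uniformly
in `i`, and each step of the scheme converges strongly because resolvents do. -/
lemma exists_tendsto_exp [l.NeBot] (hA : ∀ i, A i ∈ skewAdjoint (H →L[ℂ] H))
    (hT : Dense (T.domain : Set H))
    (hlim : ∀ ψ : T.domain, Tendsto (fun i => A i ψ) l (𝓝 (T ψ)))
    (hran : ∀ s : ℝ, Dense (Set.range fun ψ : T.domain => (ψ : H) - s • T ψ)) (t : ℝ) (x : H) :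
    ∃ y, Tendsto (fun i => NormedSpace.exp (t • A i) x) l (𝓝 y) := by
  refine exists_tendsto_of_approx fun ε hε => ?_
  obtain ⟨x₁, hx₁, hd₁⟩ := hT.exists_dist_lt x (ε := ε / 10) (by positivity)
  -- `x ≈ x₁ ≈ (1 - A_i)⁻¹ w₁` and `w₁ ≈ x₂ ≈ (1 - A_i)⁻¹ w`, with `w` independent of `i`
  set w₁ := x₁ - (1 : ℝ) • T ⟨x₁, hx₁⟩ with hw₁
  obtain ⟨x₂, hx₂, hd₂⟩ := hT.exists_dist_lt w₁ (ε := ε / 10) (by positivity)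
  set w := x₂ - (1 : ℝ) • T ⟨x₂, hx₂⟩ with hw
  have ht₁ := tendsto_resolventAt hA hlim 1 ⟨x₁, hx₁⟩
  have ht₂ := tendsto_resolventAt hA hlim 1 ⟨x₂, hx₂⟩
  obtain ⟨k, hk0, hk⟩ : ∃ k : ℕ, 0 < k ∧ t ^ 2 * (4 * ‖w‖) / k ≤ ε / 10 := by
    obtain ⟨k, hk⟩ := exists_nat_gt (t ^ 2 * (4 * ‖w‖) / (ε / 10))
    have hk0 : (0 : ℝ) < k := lt_of_le_of_lt (by positivity) hk
    refine ⟨k, by exact_mod_cast hk0, ?_⟩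
    rw [div_le_iff₀ hk0]
    rw [div_lt_iff₀ (by positivity)] at hk
    linarith
  have hk0' : (k : ℝ) ≠ 0 := by exact_mod_cast hk0.ne'
  refine ⟨_, exists_tendsto_resolventAt_pow hA hlim (hran (t / k)) k x, ?_⟩
  filter_upwards [(Metric.tendsto_nhds.mp ht₁) (ε / 10) (by positivity),
    (Metric.tendsto_nhds.mp ht₂) (ε / 10) (by positivity)] with i hi₁ hi₂
  set J := resolventAt (A i) 1 with hJ
  have hJn : ∀ v, ‖J v‖ ≤ ‖v‖ := norm_resolventAt_apply_le (hA i) 1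
  have hclose : ‖x - J (J w)‖ ≤ 4 * (ε / 10) := by
    have e : x - J (J w) = (x - x₁) - (J w₁ - x₁) + J (w₁ - x₂) - J (J w - x₂) := by
      simp only [map_sub]; abel
    have h1 : ‖J (w₁ - x₂)‖ ≤ ε / 10 := (hJn _).trans (by rw [← dist_eq_norm]; exact hd₂.le)
    have h2 : ‖J (J w - x₂)‖ ≤ ε / 10 := (hJn _).trans (by rw [← dist_eq_norm]; exact hi₂.le)
    rw [dist_eq_norm] at hd₁ hi₁
    rw [e]
    refine (norm_sub_le _ _).trans ?_
    refine (add_le_add_left (norm_add_le _ _) _).trans ?_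
    refine (add_le_add_left (add_le_add_left (norm_sub_le _ _) _) _).trans ?_
    linarith
  have hA2 : ‖A i (A i (J (J w)))‖ ≤ 4 * ‖w‖ := by
    rw [apply_resolventAt (hA i)]
    refine (norm_apply_resolventAt_one_le (hA i) _).trans ?_
    linarith [norm_apply_resolventAt_one_le (hA i) w]
  have heuler := norm_exp_apply_sub_resolventAt_pow_le (hA i) (t / k) k (J (J w))
  rw [mul_div_cancel₀ _ hk0'] at heuler
  have hbound : (k : ℝ) * ((t / k) ^ 2 * ‖A i (A i (J (J w)))‖) ≤ ε / 10 := by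
    refine le_trans ?_ hk
    have : (k : ℝ) * ((t / k) ^ 2 * ‖A i (A i (J (J w)))‖)
        = t ^ 2 * ‖A i (A i (J (J w)))‖ / k := by field_simp
    rw [this]
    gcongr
  have hpow : ∀ (j : ℕ) v, ‖(resolventAt (A i) (t / k) ^ j) v‖ ≤ ‖v‖ := by
    intro j
    induction j with
    | zero => intro v; simp
    | succ j ih =>
      intro v
      rw [pow_succ, mul_apply_eq_comp]
      exact (ih _).trans (norm_resolventAt_apply_le (hA i) _ _)
  have e : NormedSpace.exp (t • A i) x - (resolventAt (A i) (t / k) ^ k) x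
      = NormedSpace.exp (t • A i) (x - J (J w))
        - (resolventAt (A i) (t / k) ^ k) (x - J (J w))
        + (NormedSpace.exp (t • A i) (J (J w)) - (resolventAt (A i) (t / k) ^ k) (J (J w))) := by
    rw [map_sub (NormedSpace.exp (t • A i)), map_sub (resolventAt (A i) (t / k) ^ k)]; abel
  rw [dist_eq_norm, e]
  refine (norm_add_le _ _).trans ?_
  refine (add_le_add_left (norm_sub_le _ _) _).trans ?_
  rw [norm_exp_apply (hA i)]
  linarith [hpow k (x - J (J w))]

/-- **Trotter–Kato theorem** for unitary groups, together with the existence of the limit group.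
If bounded skew-adjoint operators `A_i` converge strongly, on the dense domain of `T`, to `T`, and
all `1 - s T` with `s` real have dense range, then the closure of `T` generates a unitary group,
which is the strong limit of the groups `e^{tA_i}`. -/
theorem exists_isUnitaryGroupGeneratedBy [l.NeBot] (hA : ∀ i, A i ∈ skewAdjoint (H →L[ℂ] H))
    (hT : Dense (T.domain : Set H))
    (hlim : ∀ ψ : T.domain, Tendsto (fun i => A i ψ) l (𝓝 (T ψ)))
    (hran : ∀ s : ℝ, Dense (Set.range fun ψ : T.domain => (ψ : H) - s • T ψ)) :
    ∃ U, IsUnitaryGroupGeneratedBy U T ∧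
      ∀ t x, Tendsto (fun i => NormedSpace.exp (t • A i) x) l (𝓝 (U t x)) := by
  have hskew := isSkewSymmetric_of_tendsto hA hlim
  choose V hV using exists_tendsto_exp hA hT hlim hran
  have hVnorm : ∀ t x, ‖V t x‖ = ‖x‖ := fun t x =>
    tendsto_nhds_unique (hV t x).norm (by simp [norm_exp_apply (hA _)])
  let U : ℝ → H →L[ℂ] H := fun t => LinearMap.mkContinuous
    { toFun := V t
      map_add' := fun x y => tendsto_nhds_unique (hV t (x + y))
        (by simpa only [map_add] using (hV t x).add (hV t y))
      map_smul' := fun c x => tendsto_nhds_unique (hV t (c • x))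
        (by simpa only [map_smul] using! (hV t x).const_smul c) } 1
    (fun x => by simpa using (hVnorm t x).le)
  have hU : ∀ t x, Tendsto (fun i => NormedSpace.exp (t • A i) x) l (𝓝 (U t x)) := hV
  have hUnorm : ∀ t x, ‖U t x‖ = ‖x‖ := hVnorm
  have hzero : U 0 = 1 := by
    ext x
    exact tendsto_nhds_unique (hU 0 x) (by simp)
  have hadd : ∀ s t, U (s + t) = U s * U t := by
    intro s t
    ext x
    refine tendsto_nhds_unique (hU (s + t) x) ?_
    refine (tendsto_apply_of_contraction (fun i v => (norm_exp_apply (hA i) s v).le) (hU t x)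
      (hU s (U t x))).congr fun i => ?_
    rw [exp_add_smul, mul_apply_eq_comp]
  have hunit : ∀ t, U t ∈ unitary (H →L[ℂ] H) := by
    intro t
    have h1 : star (U t) * U t = 1 :=
      (ContinuousLinearMap.norm_map_iff_adjoint_comp_self (U t)).mp (hUnorm t)
    have h2 : U t * U (-t) = 1 := by rw [← hadd, add_neg_cancel, hzero]
    have h3 : star (U t) = U (-t) := left_inv_eq_right_inv h1 h2
    exact Unitary.mem_iff.mpr ⟨h1, by rw [h3, h2]⟩
  -- the Taylor bound of the bounded case, first on the graph of `T`, then on its closure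
  have hbound : ∀ (t : ℝ) (z : T.domain), ∀ p ∈ T.closure.graph,
      ‖U t p.1 - p.1 - t • p.2‖ ≤ |t| * (2 * ‖p.2 - z‖ + |t| * ‖T z‖) := by
    intro t z p hp
    rw [mem_closure_graph_iff (hskew.isClosable hT)] at hp
    refine closure_minimal
      (t := {p : H × H | ‖U t p.1 - p.1 - t • p.2‖ ≤ |t| * (2 * ‖p.2 - z‖ + |t| * ‖T z‖)})
      ?_ (isClosed_le (by fun_prop) (by fun_prop)) hp
    rintro ⟨a, b⟩ hab
    obtain ⟨a', rfl, rfl⟩ := (LinearPMap.mem_graph_iff T).mp hab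
    refine le_of_tendsto_of_tendsto (b := l)
        (f := fun i => ‖NormedSpace.exp (t • A i) (a' : H) - a' - t • A i a'‖)
        (g := fun i => |t| * (2 * ‖A i a' - z‖ + |t| * ‖A i z‖)) ?_ ?_
        (Eventually.of_forall fun i => norm_exp_apply_sub_sub_le (hA i) t a' z)
    · exact (((hU t a').sub_const _).sub ((hlim a').const_smul t)).norm
    · exact ((((hlim a').sub_const _).norm.const_mul 2).add ((hlim z).norm.const_mul |t|)).const_mul
        |t|
  have hderiv : ∀ p ∈ T.closure.graph, HasDerivAt (fun t => U t p.1) p.2 0 := by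
    intro p hp
    rw [hasDerivAt_iff_isLittleO_nhds_zero, Asymptotics.isLittleO_iff]
    intro c hc
    obtain ⟨z, hz, hzd⟩ := hT.exists_dist_lt p.2 (ε := c / 4) (by positivity)
    have hlim0 : ∀ᶠ t : ℝ in 𝓝 0, |t| * ‖T ⟨z, hz⟩‖ < c / 2 := by
      have : Tendsto (fun t : ℝ => |t| * ‖T ⟨z, hz⟩‖) (𝓝 0) (𝓝 (|0| * ‖T ⟨z, hz⟩‖)) :=
        (continuous_abs.tendsto 0).mul_const _
      rw [abs_zero, zero_mul] at this
      exact this.eventually (gt_mem_nhds (by positivity))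
    filter_upwards [hlim0] with t ht
    rw [dist_eq_norm] at hzd
    rw [zero_add, hzero, Real.norm_eq_abs]
    refine (hbound t ⟨z, hz⟩ p hp).trans ?_
    rw [mul_comm c]
    gcongr
    simp only
    linarith
  refine ⟨U, ⟨hunit, hzero, hadd, ?_, ?_⟩, hU⟩
  · -- continuity at `0`, first on the domain of `T`
    have hlip : ∀ (t : ℝ) (z : T.domain), ‖U t z - z‖ ≤ |t| * ‖T z‖ := fun t z =>
      le_of_tendsto_of_tendsto ((hU t z).sub_const _).norm ((hlim z).norm.const_mul |t|)
        (Eventually.of_forall fun i => norm_exp_apply_sub_le (hA i) t z)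
    have hcont0 : ∀ x, Tendsto (fun t => U t x) (𝓝 0) (𝓝 x) := by
      intro x
      rw [Metric.tendsto_nhds]
      intro ε hε
      obtain ⟨z, hz, hzd⟩ := hT.exists_dist_lt x (ε := ε / 3) (by positivity)
      have hlim0 : ∀ᶠ t : ℝ in 𝓝 0, |t| * ‖T ⟨z, hz⟩‖ < ε / 3 := by
        have : Tendsto (fun t : ℝ => |t| * ‖T ⟨z, hz⟩‖) (𝓝 0) (𝓝 (|0| * ‖T ⟨z, hz⟩‖)) :=
          (continuous_abs.tendsto 0).mul_const _
        rw [abs_zero, zero_mul] at this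
        exact this.eventually (gt_mem_nhds (by positivity))
      filter_upwards [hlim0] with t ht
      have e : U t x - x = U t (x - z) + (U t z - z) - (x - z) := by rw [map_sub]; abel
      rw [dist_eq_norm] at hzd ⊢
      rw [e]
      refine (norm_sub_le _ _).trans_lt ?_
      have h1 := norm_add_le (U t (x - z)) (U t z - z)
      rw [hUnorm] at h1
      linarith [hlip t ⟨z, hz⟩]
    intro x
    refine continuous_iff_continuousAt.mpr fun t => ?_
    have h1 : Tendsto (fun r => U (r - t) x) (𝓝 t) (𝓝 x) :=
      (hcont0 x).comp (by simpa using (continuous_sub_right t).tendsto t)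
    refine (((U t).continuous.tendsto x).comp h1).congr fun r => ?_
    change (U t * U (r - t)) x = U r x
    rw [← hadd]
    simp
  · intro x y
    refine ⟨fun h => hderiv _ h, fun h => ?_⟩
    -- if `t ↦ U t x` has derivative `y` at `0`, choose `(p.1, p.2)` in the graph of `T̄` with
    -- `p.1 - p.2 = x - y`; the generator is skew-symmetric, which forces `x = p.1` and `y = p.2`
    obtain ⟨p, hp, hpe⟩ := hskew.exists_sub_smul_eq hT one_ne_zero (hran 1) (x - (1 : ℝ) • y)
    have hd : HasDerivAt (fun t => U t (x - p.1)) (y - p.2) 0 := by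
      simpa only [map_sub] using! h.sub (hderiv p hp)
    have hre : (inner ℂ (x - p.1) (y - p.2)).re = 0 := by
      let _ : InnerProductSpace ℝ H := InnerProductSpace.rclikeToReal ℂ H
      have h1 := hd.norm_sq
      simp only [hUnorm, hzero] at h1
      have h2 := h1.unique (hasDerivAt_const 0 _)
      rw [real_inner_eq_re_inner ℂ] at h2
      simpa [inner_sub_left, inner_sub_right] using h2
    have hsq := norm_sub_smul_sq hre 1
    have e : x - p.1 - (1 : ℝ) • (y - p.2) = 0 := by
      rw [smul_sub, sub_sub_sub_comm, ← hpe, sub_self]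
    rw [e, norm_zero] at hsq
    have h1 : ‖x - p.1‖ = 0 := by
      nlinarith [sq_nonneg ‖x - p.1‖, sq_nonneg ‖y - p.2‖]
    have h2 : ‖y - p.2‖ = 0 := by
      nlinarith [sq_nonneg ‖x - p.1‖, sq_nonneg ‖y - p.2‖]
    rw [norm_eq_zero, sub_eq_zero] at h1 h2
    rw [h1, h2]
    exact hp

/-- The form in which the theory is applied: operators `S_i` that are bounded, everywhere defined
and skew-adjoint, and that converge strongly to `T` on the domain of `T`. -/
theorem tendsto_unitaryExp [l.NeBot] {S : ι → H →ₗ.[ℂ] H} (hA : ∀ i, A i ∈ skewAdjoint (H →L[ℂ] H))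
    (hS : ∀ i x y, (x, y) ∈ (S i).graph ↔ A i x = y)
    (hran : ∀ s : ℝ, Dense (Set.range fun ψ : T.domain => (ψ : H) - (s : ℂ) • T ψ))
    (hlim : ∀ ψ : T.domain, Tendsto (fun i => A i ψ) l (𝓝 (T ψ))) :
    (IsEssentiallySkewAdjoint T ∧ ∃! U, IsUnitaryGroupGeneratedBy U T) ∧
    (∀ i, IsEssentiallySkewAdjoint (S i) ∧ ∃! U, IsUnitaryGroupGeneratedBy U (S i)) ∧
    ∀ (t : ℝ) (x : H), Tendsto (fun i => unitaryExp (S i) t x) l (𝓝 (unitaryExp T t x)) := by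
  replace hran : ∀ s : ℝ, Dense (Set.range fun ψ : T.domain => (ψ : H) - s • T ψ) := by
    simpa only [Complex.coe_smul] using hran
  have hT : Dense (T.domain : Set H) := by simpa using hran 0
  have hskew := isSkewSymmetric_of_tendsto hA hlim
  obtain ⟨U, hU, hUlim⟩ := exists_isUnitaryGroupGeneratedBy hA hT hlim hran
  have hSval : ∀ i (ψ : (S i).domain), A i ψ = S i ψ := fun i ψ =>
    (hS i _ _).mp ((S i).mem_graph ψ)
  have hSdom : ∀ i x, x ∈ (S i).domain := fun i x =>
    LinearPMap.mem_domain_of_mem_graph ((hS i x _).mpr rfl)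
  have hSdense : ∀ i, Dense ((S i).domain : Set H) := fun i => by
    rw [Set.eq_univ_of_forall (s := ((S i).domain : Set H)) (hSdom i)]
    exact dense_univ
  have hSran : ∀ i (s : ℝ), Dense (Set.range fun ψ : (S i).domain => (ψ : H) - s • S i ψ) := by
    intro i s
    rw [Set.eq_univ_of_forall (s := Set.range _) fun z => ?_]
    · exact dense_univ
    · refine ⟨⟨resolventAt (A i) s z, hSdom i _⟩, ?_⟩
      simp only
      rw [← hSval]
      exact sub_resolventAt_apply (hA i) s z
  -- the theorem for the constant family `A i`
  have hconst : ∀ i, IsSkewSymmetric (S i) ∧ ∃ V, IsUnitaryGroupGeneratedBy V (S i) ∧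
      ∀ t x, NormedSpace.exp (t • A i) x = V t x := by
    intro i
    have hlim' : ∀ ψ : (S i).domain, Tendsto (fun _ : Unit => A i ψ) ⊤ (𝓝 (S i ψ)) := fun ψ => by
      rw [hSval]; exact tendsto_const_nhds
    obtain ⟨V, hV, hVlim⟩ := exists_isUnitaryGroupGeneratedBy (fun _ : Unit => hA i) (hSdense i)
      hlim' (hSran i)
    exact ⟨isSkewSymmetric_of_tendsto (fun _ : Unit => hA i) hlim', V, hV, fun t x =>
      tendsto_nhds_unique tendsto_const_nhds (hVlim t x)⟩
  refine ⟨⟨hskew.isEssentiallySkewAdjoint hT hran, U, hU, fun W hW => hW.unique hskew hT hU⟩,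
    fun i => ?_, fun t x => ?_⟩
  · obtain ⟨hsk, V, hV, -⟩ := hconst i
    exact ⟨hsk.isEssentiallySkewAdjoint (hSdense i) (hSran i), V, hV,
      fun W hW => hW.unique hsk (hSdense i) hV⟩
  · rw [unitaryExp_eq hskew hT hU]
    refine (hUlim t x).congr fun i => ?_
    obtain ⟨hsk, V, hV, hVexp⟩ := hconst i
    rw [unitaryExp_eq hsk (hSdense i) hV, hVexp]

end Generation

/-! ### The Wirtinger derivative -/

section Wirtinger

variable {m : ℕ}

lemma dbar_add (k : Fin m) {f g : (Fin m → ℂ) → ℂ} {z : Fin m → ℂ}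
    (hf : DifferentiableAt ℝ f z) (hg : DifferentiableAt ℝ g z) :
    dbar k (fun z => f z + g z) z = dbar k f z + dbar k g z := by
  simp only [dbar, fderiv_fun_add hf hg, add_apply]
  ring

lemma dbar_mul (k : Fin m) {f g : (Fin m → ℂ) → ℂ} {z : Fin m → ℂ}
    (hf : DifferentiableAt ℝ f z) (hg : DifferentiableAt ℝ g z) :
    dbar k (fun z => f z * g z) z = f z * dbar k g z + g z * dbar k f z := by
  simp only [dbar, fderiv_fun_mul hf hg, add_apply, smul_apply, smul_eq_mul]
  ring

lemma dbar_const (k : Fin m) (c : ℂ) (z : Fin m → ℂ) : dbar k (fun _ => c) z = 0 := by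
  simp [dbar]

lemma dbar_coord (k j : Fin m) (z : Fin m → ℂ) : dbar k (fun z => z j) z = 0 := by
  have h : fderiv ℝ (fun z : Fin m → ℂ => z j) z = ContinuousLinearMap.proj j :=
    (ContinuousLinearMap.proj (R := ℝ) (φ := fun _ : Fin m => ℂ) j).fderiv
  rcases eq_or_ne j k with rfl | hjk
  · simp [dbar, h]
  · simp [dbar, h, hjk]

lemma dbar_star_coord (k j : Fin m) (z : Fin m → ℂ) :
    dbar k (fun z => star z j) z = if j = k then 1 else 0 := by
  have h : fderiv ℝ (fun z : Fin m → ℂ => star z j) z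
      = (Complex.conjCLE : ℂ →L[ℝ] ℂ).comp (ContinuousLinearMap.proj j) :=
    ((Complex.conjCLE : ℂ →L[ℝ] ℂ).comp
      (ContinuousLinearMap.proj (R := ℝ) (φ := fun _ : Fin m => ℂ) j)).fderiv
  rcases eq_or_ne j k with rfl | hjk
  · simp only [dbar, h]
    simp
  · simp only [dbar, h]
    simp [hjk]

lemma dbar_cexp (k : Fin m) {f : (Fin m → ℂ) → ℂ} {z : Fin m → ℂ} (hf : DifferentiableAt ℝ f z) :
    dbar k (fun z => Complex.exp (f z)) z = Complex.exp (f z) * dbar k f z := by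
  have h : fderiv ℝ (fun z => Complex.exp (f z)) z = Complex.exp (f z) • fderiv ℝ f z :=
    hf.hasFDerivAt.cexp.fderiv
  simp only [dbar, h, smul_apply, smul_eq_mul]
  ring

end Wirtinger

/-! ### Polynomials in `z` and `z̄` times the Gaussian -/

section GaussianPolynomials

variable {m : ℕ}

/-- Polynomials in `z₁, …, z_m` (the variables `inl k`) and `z̄₁, …, z̄_m` (the variables
`inr k`). -/
abbrev Poly (m : ℕ) : Type := MvPolynomial (Fin m ⊕ Fin m) ℂ

open MvPolynomial

/-- The function `z ↦ q(z, z̄)`. -/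
noncomputable def polyEval (q : Poly m) (z : Fin m → ℂ) : ℂ := eval (Sum.elim z (star z)) q

lemma polyEval_add (p q : Poly m) (z : Fin m → ℂ) :
    polyEval (p + q) z = polyEval p z + polyEval q z := map_add _ _ _

lemma polyEval_mul (p q : Poly m) (z : Fin m → ℂ) :
    polyEval (p * q) z = polyEval p z * polyEval q z := map_mul _ _ _

lemma polyEval_C (c : ℂ) (z : Fin m → ℂ) : polyEval (C c : Poly m) z = c := eval_C _

lemma polyEval_inl (k : Fin m) (z : Fin m → ℂ) : polyEval (X (Sum.inl k)) z = z k := eval_X _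

lemma polyEval_inr (k : Fin m) (z : Fin m → ℂ) : polyEval (X (Sum.inr k)) z = star z k := eval_X _

lemma contDiff_polyEval (q : Poly m) : ContDiff ℝ ∞ (polyEval q) := by
  induction q using MvPolynomial.induction_on with
  | C c => simpa only [funext (polyEval_C c)] using contDiff_const
  | add p q hp hq => simpa only [funext (polyEval_add p q)] using hp.add hq
  | mul_X p i hp =>
    simp only [funext (polyEval_mul p (X i))]
    refine hp.mul ?_
    rcases i with i | i
    · simpa only [funext (polyEval_inl i)] using contDiff_apply ℝ ℂ i
    · simp only [funext (polyEval_inr i)]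
      exact Complex.conjCLE.contDiff.comp (contDiff_apply ℝ ℂ i)

lemma differentiableAt_polyEval (q : Poly m) (z : Fin m → ℂ) :
    DifferentiableAt ℝ (polyEval q) z :=
  (contDiff_polyEval q).differentiable (by simp) z

lemma dbar_polyEval (k : Fin m) (q : Poly m) (z : Fin m → ℂ) :
    dbar k (polyEval q) z = polyEval (pderiv (Sum.inr k) q) z := by
  induction q using MvPolynomial.induction_on with
  | C c =>
    rw [funext (polyEval_C c), dbar_const, pderiv_C]
    simp [polyEval]
  | add p q hp hq =>
    rw [funext (polyEval_add p q), dbar_add k (differentiableAt_polyEval p z)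
      (differentiableAt_polyEval q z), map_add, polyEval_add, hp, hq]
  | mul_X p i hp =>
    rw [funext (polyEval_mul p (X i)), dbar_mul k (differentiableAt_polyEval p z)
      (differentiableAt_polyEval _ z), hp, pderiv_mul, polyEval_add, polyEval_mul, polyEval_mul]
    have hX : dbar k (polyEval (X i)) z = polyEval (pderiv (Sum.inr k) (X i)) z := by
      rcases i with i | i
      · rw [funext (polyEval_inl i), dbar_coord, pderiv_X_of_ne (by simp)]
        simp [polyEval]
      · rw [funext (polyEval_inr i), dbar_star_coord]
        rcases eq_or_ne i k with rfl | h
        · simp [polyEval]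
        · rw [pderiv_X_of_ne (by simpa using h)]
          simp [polyEval, h]
    rw [hX]
    ring

/-- The sum of the moduli of the coordinates. -/
noncomputable def absSum (z : Fin m → ℂ) : ℝ := ∑ k, ‖z k‖

lemma absSum_nonneg (z : Fin m → ℂ) : 0 ≤ absSum z := Finset.sum_nonneg fun _ _ => norm_nonneg _

lemma norm_coord_le_absSum (z : Fin m → ℂ) (k : Fin m) : ‖z k‖ ≤ absSum z :=
  Finset.single_le_sum (f := fun k => ‖z k‖) (fun _ _ => norm_nonneg _) (Finset.mem_univ k)

/-- `f` grows at most exponentially. Continuous functions of this kind are in `L²` after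
multiplication by the Gaussian. -/
def ExpGrowth (f : (Fin m → ℂ) → ℂ) : Prop :=
  ∃ C N : ℝ, 0 ≤ C ∧ 0 ≤ N ∧ ∀ z, ‖f z‖ ≤ C * Real.exp (N * absSum z)

lemma ExpGrowth.add {f g : (Fin m → ℂ) → ℂ} (hf : ExpGrowth f) (hg : ExpGrowth g) :
    ExpGrowth (fun z => f z + g z) := by
  obtain ⟨C, N, hC, hN, h⟩ := hf
  obtain ⟨C', N', hC', hN', h'⟩ := hg
  refine ⟨C + C', N + N', by positivity, by positivity, fun z => ?_⟩
  have hz := absSum_nonneg z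
  refine (norm_add_le _ _).trans ?_
  rw [add_mul]
  refine add_le_add ((h z).trans ?_) ((h' z).trans ?_)
  · gcongr; linarith
  · gcongr; linarith

lemma ExpGrowth.mul {f g : (Fin m → ℂ) → ℂ} (hf : ExpGrowth f) (hg : ExpGrowth g) :
    ExpGrowth (fun z => f z * g z) := by
  obtain ⟨C, N, hC, hN, h⟩ := hf
  obtain ⟨C', N', hC', hN', h'⟩ := hg
  refine ⟨C * C', N + N', by positivity, by positivity, fun z => ?_⟩
  rw [norm_mul, add_mul, Real.exp_add, mul_mul_mul_comm]
  gcongr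
  exacts [h z, h' z]

lemma expGrowth_polyEval (q : Poly m) : ExpGrowth (polyEval q) := by
  induction q using MvPolynomial.induction_on with
  | C c => exact ⟨‖c‖, 0, norm_nonneg _, le_rfl, fun z => by simp [polyEval_C]⟩
  | add p q hp hq => simpa only [funext (polyEval_add p q)] using hp.add hq
  | mul_X p i hp =>
    simp only [funext (polyEval_mul p (X i))]
    refine hp.mul ⟨1, 1, zero_le_one, zero_le_one, fun z => ?_⟩
    have h : ‖polyEval (X i) z‖ ≤ absSum z := by
      rcases i with i | i
      · rw [polyEval_inl]; exact norm_coord_le_absSum z i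
      · rw [polyEval_inr, Pi.star_apply, norm_star]; exact norm_coord_le_absSum z i
    have := Real.add_one_le_exp (absSum z)
    rw [one_mul, one_mul]
    linarith

/-- The Gaussian `e^{-|z|²/2}`, as the exponential of a polynomial in `z` and `z̄`, so that the
rules for `dbar` apply to it; `gaussian_eq` gives the explicit form. -/
noncomputable def gaussian (z : Fin m → ℂ) : ℂ :=
  Complex.exp (polyEval (C (-1 / 2) * ∑ k : Fin m, X (Sum.inl k) * X (Sum.inr k)) z)

lemma gaussian_eq (z : Fin m → ℂ) :
    gaussian z = ((Real.exp (-(∑ k, ‖z k‖ ^ 2) / 2) : ℝ) : ℂ) := by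
  rw [gaussian, Complex.ofReal_exp]
  congr 1
  simp only [polyEval, map_mul, map_sum, eval_C, eval_X, Sum.elim_inl, Sum.elim_inr, Pi.star_apply]
  simp_rw [← starRingEnd_apply, Complex.mul_conj, Complex.normSq_eq_norm_sq]
  push_cast
  ring

lemma gaussian_ne_zero (z : Fin m → ℂ) : gaussian z ≠ 0 := Complex.exp_ne_zero _

lemma conj_gaussian (z : Fin m → ℂ) : (starRingEnd ℂ) (gaussian z) = gaussian z := by
  rw [gaussian_eq, Complex.conj_ofReal]

lemma contDiff_gaussian : ContDiff ℝ ∞ (gaussian : (Fin m → ℂ) → ℂ) :=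
  (contDiff_polyEval _).cexp

lemma dbar_gaussian (k : Fin m) (z : Fin m → ℂ) : dbar k gaussian z = -(z k / 2) * gaussian z := by
  have h := dbar_cexp k (differentiableAt_polyEval
    (C (-1 / 2) * ∑ k : Fin m, X (Sum.inl k) * X (Sum.inr k)) z)
  change dbar k gaussian z = gaussian z * _ at h
  rw [h, dbar_polyEval, pderiv_C_mul, map_sum]
  have : ∀ j : Fin m, pderiv (Sum.inr k) (X (Sum.inl j) * X (Sum.inr j) : Poly m)
      = if j = k then X (Sum.inl j) else 0 := by
    intro j
    rw [pderiv_mul, pderiv_X_of_ne (by simp)]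
    rcases eq_or_ne j k with rfl | hj
    · simp
    · rw [pderiv_X_of_ne (by simpa using hj)]; simp [hj]
  simp only [this, Finset.sum_ite_eq', Finset.mem_univ, if_true]
  rw [polyEval_mul, polyEval_C, polyEval_inl]
  ring

lemma ExpGrowth.memLp {f : (Fin m → ℂ) → ℂ} (hf : ExpGrowth f) (hc : Continuous f) :
    MemLp (fun z => f z * gaussian z) 2 volume := by
  obtain ⟨C, N, hC, hN, h⟩ := hf
  have hcont : Continuous fun z => f z * gaussian z := hc.mul contDiff_gaussian.continuous
  rw [memLp_two_iff_integrable_sq_norm hcont.aestronglyMeasurable]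
  have hint : Integrable (fun w : ℂ => Real.exp (2 * N ^ 2) * Real.exp (-(1 / 2) * ‖w‖ ^ 2)) := by
    have h1 := (GaussianFourier.integrable_cexp_neg_mul_sq_norm_add (V := ℂ) (b := 1 / 2)
      (by norm_num) 0 0).norm.const_mul (Real.exp (2 * N ^ 2))
    refine h1.congr (Eventually.of_forall fun w => ?_)
    simp only [zero_mul, add_zero, Complex.norm_exp]
    congr 2
    rw [← Complex.ofReal_pow, Complex.re_mul_ofReal]
    norm_num
  have hprod := (Integrable.fintype_prod (ι := Fin m) (μ := fun _ => (volume : Measure ℂ))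
    (fun _ => hint)).const_mul (C ^ 2)
  refine hprod.mono' (hcont.norm.pow 2).aestronglyMeasurable (Eventually.of_forall fun z => ?_)
  rw [Real.norm_of_nonneg (by positivity), norm_mul, gaussian_eq, Complex.norm_real,
    Real.norm_of_nonneg (Real.exp_pos _).le]
  have e : ∏ k : Fin m, Real.exp (2 * N ^ 2) * Real.exp (-(1 / 2) * ‖z k‖ ^ 2)
      = Real.exp (∑ k : Fin m, (2 * N ^ 2 + -(1 / 2) * ‖z k‖ ^ 2)) := by
    rw [Real.exp_sum]
    exact Finset.prod_congr rfl fun k _ => (Real.exp_add _ _).symm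
  rw [e, mul_pow]
  calc ‖f z‖ ^ 2 * Real.exp (-(∑ k, ‖z k‖ ^ 2) / 2) ^ 2
      ≤ (C * Real.exp (N * absSum z)) ^ 2 * Real.exp (-(∑ k, ‖z k‖ ^ 2) / 2) ^ 2 := by
        gcongr; exact h z
    _ = C ^ 2 * Real.exp (∑ k : Fin m, (2 * N * ‖z k‖ - ‖z k‖ ^ 2)) := by
        rw [mul_pow, mul_assoc, ← Real.exp_nat_mul, ← Real.exp_nat_mul, ← Real.exp_add,
          Finset.sum_sub_distrib, ← Finset.mul_sum, absSum]
        congr 2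
        push_cast
        ring
    _ ≤ _ := by
        gcongr with k
        -- `2 N r - r² ≤ 2 N² - r² / 2`
        nlinarith [sq_nonneg (2 * N - ‖z k‖)]

lemma memLp_poly (q : Poly m) : MemLp (fun z => polyEval q z * gaussian z) 2 volume :=
  (expGrowth_polyEval q).memLp (contDiff_polyEval q).continuous

/-- The vector `q(z, z̄) e^{-|z|²/2}` of `L²(ℂ^m)`. -/
noncomputable def gaussPoly (m : ℕ) : Poly m →ₗ[ℂ] L2 m where
  toFun q := (memLp_poly q).toLp
  map_add' p q := by
    rw [← MemLp.toLp_add]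
    apply MemLp.toLp_congr
    exact Eventually.of_forall fun z => by
      simp only [polyEval_add, add_mul, Pi.add_apply]
  map_smul' c q := by
    rw [RingHom.id_apply, ← MemLp.toLp_const_smul]
    apply MemLp.toLp_congr
    exact Eventually.of_forall fun z => by
      simp only [smul_eq_C_mul, polyEval_mul, polyEval_C, Pi.smul_apply, smul_eq_mul, mul_assoc]

lemma coeFn_gaussPoly (q : Poly m) :
    gaussPoly m q =ᵐ[volume] fun z => polyEval q z * gaussian z :=
  (memLp_poly q).coeFn_toLp

/-- Complex conjugation of polynomials in `z` and `z̄`. -/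
noncomputable def conjPoly : Poly m →+* Poly m :=
  (rename Sum.swap : Poly m →ₐ[ℂ] Poly m).toRingHom.comp (map (starRingEnd ℂ))

lemma polyEval_conjPoly (q : Poly m) (z : Fin m → ℂ) :
    polyEval (conjPoly q) z = (starRingEnd ℂ) (polyEval q z) := by
  have h : (eval (Sum.elim z (star z))).comp conjPoly
      = (starRingEnd ℂ).comp (eval (Sum.elim z (star z))) := by
    refine MvPolynomial.ringHom_ext (fun c => ?_) (fun i => ?_)
    · simp [conjPoly]
    · rcases i with i | i <;> simp [conjPoly]
  exact RingHom.congr_fun h q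

lemma conjPoly_X (i : Fin m ⊕ Fin m) : conjPoly (X i : Poly m) = X i.swap := by
  simp [conjPoly]

lemma conjPoly_conjPoly (q : Poly m) : conjPoly (conjPoly q) = q := by
  have h : (conjPoly (m := m)).comp conjPoly = RingHom.id _ := by
    refine MvPolynomial.ringHom_ext (fun c => ?_) (fun i => ?_)
    · simp [conjPoly]
    · simp [conjPoly_X]
  exact RingHom.congr_fun h q

lemma pderiv_conjPoly (i : Fin m ⊕ Fin m) (q : Poly m) :
    pderiv i.swap (conjPoly q) = conjPoly (pderiv i q) := by
  change pderiv i.swap (rename Sum.swap (map (starRingEnd ℂ) q)) = _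
  rw [pderiv_rename (Sum.swap_leftInverse.injective), pderiv_map]
  rfl

lemma inner_gaussPoly_left (q : Poly m) (ψ : L2 m) :
    inner ℂ (gaussPoly m q) ψ = ∫ z, ψ z * (polyEval (conjPoly q) z * gaussian z) := by
  rw [L2.inner_def]
  refine integral_congr_ae ?_
  filter_upwards [coeFn_gaussPoly q] with z hz
  rw [hz, RCLike.inner_apply, map_mul, conj_gaussian, polyEval_conjPoly]

lemma inner_gaussPoly_gaussPoly (p q : Poly m) :
    inner ℂ (gaussPoly m p) (gaussPoly m q)
      = ∫ z, polyEval (conjPoly p * q) z * (gaussian z * gaussian z) := by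
  rw [inner_gaussPoly_left]
  refine integral_congr_ae ?_
  filter_upwards [coeFn_gaussPoly q] with z hz
  rw [hz, polyEval_mul]
  ring

lemma inner_gaussPoly_mul (p q r : Poly m) :
    inner ℂ (gaussPoly m (p * q)) (gaussPoly m r)
      = inner ℂ (gaussPoly m q) (gaussPoly m (conjPoly p * r)) := by
  rw [inner_gaussPoly_gaussPoly, inner_gaussPoly_gaussPoly, map_mul, mul_comm (conjPoly p),
    mul_assoc]

end GaussianPolynomials

/-! ### The annihilation operators on Gaussian polynomials -/

section Annihilation

open MvPolynomial

variable {m : ℕ}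

lemma continuous_dbar (k : Fin m) {f : (Fin m → ℂ) → ℂ} (hf : ContDiff ℝ ∞ f) :
    Continuous (dbar k f) := by
  have hd : Continuous (fderiv ℝ f) := hf.continuous_fderiv (by simp)
  unfold dbar
  fun_prop

lemma hasCompactSupport_dbar (k : Fin m) {f : (Fin m → ℂ) → ℂ} (hf : HasCompactSupport f) :
    HasCompactSupport (dbar k f) := by
  have h1 := hf.fderiv_apply (𝕜 := ℝ) (Pi.single k (1 : ℂ))
  have h2 := hf.fderiv_apply (𝕜 := ℝ) (Pi.single k Complex.I)
  have := (h1.add (h2.mul_left (f := fun _ => Complex.I))).mul_right (f' := fun _ => (2 : ℂ)⁻¹)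
  simpa only [dbar, div_eq_mul_inv] using! this

lemma dbar_gaussPoly (k : Fin m) (q : Poly m) (z : Fin m → ℂ) :
    dbar k (fun z => polyEval q z * gaussian z) z
      = polyEval (pderiv (Sum.inr k) q) z * gaussian z
        - z k / 2 * (polyEval q z * gaussian z) := by
  rw [dbar_mul k (differentiableAt_polyEval q z)
    (contDiff_gaussian.differentiable (by simp) z), dbar_gaussian, dbar_polyEval]
  ring

lemma annihilationTranspose_gaussPoly (k : Fin m) (q : Poly m) (z : Fin m → ℂ) :
    annihilationTranspose k (fun z => polyEval q z * gaussian z) z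
      = polyEval (X (Sum.inl k) * q - pderiv (Sum.inr k) q) z * gaussian z := by
  rw [annihilationTranspose, dbar_gaussPoly]
  simp only [polyEval, map_sub, map_mul, eval_X, Sum.elim_inl]
  ring

/-- Integration by parts for `∂/∂z̄_k`. -/
lemma integral_mul_dbar (k : Fin m) {f φ : (Fin m → ℂ) → ℂ} (hf : ContDiff ℝ ∞ f)
    (hφ : IsTestFunction φ) : ∫ z, f z * dbar k φ z = -∫ z, dbar k f z * φ z := by
  have hfc := hf.continuous
  have hφc := hφ.1.continuous
  have hfd : Continuous (fderiv ℝ f) := hf.continuous_fderiv (by simp)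
  have hφd : Continuous (fderiv ℝ φ) := hφ.1.continuous_fderiv (by simp)
  have hi1 : ∀ v, Integrable (fun z => fderiv ℝ f z v * φ z) (volume : Measure (Fin m → ℂ)) :=
    fun v => Continuous.integrable_of_hasCompactSupport (by fun_prop) hφ.2.mul_left
  have hi2 : ∀ v, Integrable (fun z => f z * fderiv ℝ φ z v) (volume : Measure (Fin m → ℂ)) :=
    fun v => Continuous.integrable_of_hasCompactSupport (by fun_prop)
      (hφ.2.fderiv_apply (𝕜 := ℝ) v).mul_left
  have hi3 : Integrable (fun z => f z * φ z) (volume : Measure (Fin m → ℂ)) :=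
    Continuous.integrable_of_hasCompactSupport (by fun_prop) hφ.2.mul_left
  have key : ∀ v, ∫ z, f z * fderiv ℝ φ z v = -∫ z, fderiv ℝ f z v * φ z := fun v =>
    integral_mul_fderiv_eq_neg_fderiv_mul_of_integrable (hi1 v) (hi2 v) hi3
      (fun z _ => hf.differentiable (by simp) z) (fun z _ => hφ.1.differentiable (by simp) z)
  have e1 : ∀ z, f z * dbar k φ z = 1 / 2 * (f z * fderiv ℝ φ z (Pi.single k 1))
      + Complex.I / 2 * (f z * fderiv ℝ φ z (Pi.single k Complex.I)) := fun z => by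
    simp only [dbar]; ring
  have e2 : ∀ z, dbar k f z * φ z = 1 / 2 * (fderiv ℝ f z (Pi.single k 1) * φ z)
      + Complex.I / 2 * (fderiv ℝ f z (Pi.single k Complex.I) * φ z) := fun z => by
    simp only [dbar]; ring
  simp_rw [e1, e2]
  rw [integral_add ((hi2 _).const_mul _) ((hi2 _).const_mul _),
    integral_add ((hi1 _).const_mul _) ((hi1 _).const_mul _)]
  simp only [integral_const_mul, key]
  ring

/-- `b_k (q e^{-|z|²/2}) = (∂q/∂z̄_k) e^{-|z|²/2}`. -/
lemma gaussPoly_mem_annihilationGraph (k : Fin m) (q : Poly m) :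
    (gaussPoly m q, gaussPoly m (pderiv (Sum.inr k) q)) ∈ annihilationGraph m k := by
  intro φ hφ
  have hG : ContDiff ℝ ∞ (fun z => polyEval q z * gaussian z) :=
    (contDiff_polyEval q).mul contDiff_gaussian
  have hGc := hG.continuous
  have hφc := hφ.1.continuous
  have hdc := continuous_dbar k hφ.1
  have hL : ∫ z, gaussPoly m (pderiv (Sum.inr k) q) z * φ z
      = ∫ z, (dbar k (fun z => polyEval q z * gaussian z) z * φ z
        + z k / 2 * (polyEval q z * gaussian z) * φ z) := by
    refine integral_congr_ae ?_
    filter_upwards [coeFn_gaussPoly (pderiv (Sum.inr k) q)] with z hz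
    rw [hz, dbar_gaussPoly]
    ring
  have hR : ∫ z, gaussPoly m q z * annihilationTranspose k φ z
      = ∫ z, (-((polyEval q z * gaussian z) * dbar k φ z)
        + z k / 2 * (polyEval q z * gaussian z) * φ z) := by
    refine integral_congr_ae ?_
    filter_upwards [coeFn_gaussPoly q] with z hz
    rw [hz, annihilationTranspose]
    ring
  have hsupp : HasCompactSupport (dbar k φ) := hasCompactSupport_dbar k hφ.2
  change ∫ z, gaussPoly m (pderiv (Sum.inr k) q) z * φ z
    = ∫ z, gaussPoly m q z * annihilationTranspose k φ z
  rw [hL, hR, integral_add, integral_add, integral_neg, integral_mul_dbar k hG hφ, neg_neg]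
  · exact (Continuous.integrable_of_hasCompactSupport (by fun_prop) hsupp.mul_left).neg
  · exact Continuous.integrable_of_hasCompactSupport (by fun_prop) hφ.2.mul_left
  · exact Continuous.integrable_of_hasCompactSupport
      ((continuous_dbar k hG).mul hφc) hφ.2.mul_left
  · exact Continuous.integrable_of_hasCompactSupport (by fun_prop) hφ.2.mul_left

/-- The equation `b_k ψ = 0`, which is stated for compactly supported test functions, may be
tested against Gaussian polynomials. -/
lemma integral_mul_annihilationTranspose_gaussPoly {k : Fin m} {ψ : L2 m}
    (hψ : (ψ, 0) ∈ annihilationGraph m k) (q : Poly m) :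
    ∫ z, ψ z * annihilationTranspose k (fun z => polyEval q z * gaussian z) z = 0 := by
  set f : (Fin m → ℂ) → ℂ := fun z => polyEval q z * gaussian z with hf
  have hfs : ContDiff ℝ ∞ f := (contDiff_polyEval q).mul contDiff_gaussian
  have hfL : MemLp f 2 volume := memLp_poly q
  have hTL : MemLp (annihilationTranspose k f) 2 volume := by
    rw [funext (annihilationTranspose_gaussPoly k q)]
    exact memLp_poly _
  -- smooth cutoffs `χ (z / (n + 1))`
  let χ : ContDiffBump (0 : Fin m → ℂ) := ⟨1, 2, one_pos, one_lt_two⟩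
  let g : (Fin m → ℂ) → ℂ := fun z => (χ z : ℂ)
  have hgs : ContDiff ℝ ∞ g := Complex.ofRealCLM.contDiff.comp χ.contDiff
  have hgc : HasCompactSupport g := χ.hasCompactSupport.comp_left (g := Complex.ofReal) (by simp)
  have hg0 : g 0 = 1 := by
    simp only [g]
    rw [χ.one_of_mem_closedBall (by simp [χ])]
    simp
  have hg1 : ∀ z, ‖g z‖ ≤ 1 := fun z => by
    simp only [g, Complex.norm_real, Real.norm_of_nonneg χ.nonneg]
    exact χ.le_one
  obtain ⟨C, hC⟩ : ∃ C, ∀ z, ‖dbar k g z‖ ≤ C :=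
    (hasCompactSupport_dbar k hgc).exists_bound_of_continuous (continuous_dbar k hgs)
  let r : ℕ → ℝ := fun n => 1 / ((n : ℝ) + 1)
  have hr0 : ∀ n, 0 < r n := fun n => by positivity
  have hr1 : ∀ n, r n ≤ 1 := fun n => by
    simp only [r]
    rw [div_le_one (by positivity)]
    linarith [(Nat.cast_nonneg n : (0 : ℝ) ≤ n)]
  have hrlim : Tendsto r atTop (𝓝 0) := tendsto_one_div_add_atTop_nhds_zero_nat
  let G : ℕ → (Fin m → ℂ) → ℂ := fun n z => g (r n • z)
  have hGs : ∀ n, ContDiff ℝ ∞ (G n) := fun n => hgs.comp (contDiff_const_smul (r n))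
  have hGc : ∀ n, HasCompactSupport (G n) := fun n => hgc.comp_smul (hr0 n).ne'
  have hGd : ∀ n z, dbar k (G n) z = r n * dbar k g (r n • z) := by
    intro n z
    have h : fderiv ℝ (G n) z = r n • fderiv ℝ g (r n • z) := fderiv_comp_smul (r n)
    simp only [dbar, h, smul_apply, Complex.real_smul]
    ring
  have hTest : ∀ n, IsTestFunction (fun z => G n z * f z) := fun n =>
    ⟨(hGs n).mul hfs, (hGc n).mul_right⟩
  have hT : ∀ n z, annihilationTranspose k (fun z => G n z * f z) z
      = G n z * annihilationTranspose k f z - r n * dbar k g (r n • z) * f z := by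
    intro n z
    simp only [annihilationTranspose]
    rw [dbar_mul k ((hGs n).differentiable (by simp) z) (hfs.differentiable (by simp) z), hGd]
    ring
  have hzero : ∀ n, ∫ z, ψ z * annihilationTranspose k (fun z => G n z * f z) z = 0 := by
    intro n
    have h := hψ _ (hTest n)
    rw [← h, ← integral_zero (Fin m → ℂ) ℂ]
    refine integral_congr_ae ?_
    filter_upwards [Lp.coeFn_zero ℂ 2 (volume : Measure (Fin m → ℂ))] with z hz
    change (0 : L2 m) z * _ = 0
    rw [hz]
    simp
  have hlim : Tendsto (fun n => ∫ z, ψ z * annihilationTranspose k (fun z => G n z * f z) z) atTop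
      (𝓝 (∫ z, ψ z * annihilationTranspose k f z)) := by
    refine tendsto_integral_of_dominated_convergence
      (fun z => ‖ψ z * annihilationTranspose k f z‖ + C * ‖ψ z * f z‖) (fun n => ?_)
      (((integrable_mul hTL ψ).norm).add ((integrable_mul hfL ψ).norm.const_mul C)) (fun n => ?_) ?_
    · exact (integrable_mul ((hTest n).memLp_transpose k) ψ).aestronglyMeasurable
    · refine Eventually.of_forall fun z => ?_
      rw [hT, mul_sub]
      refine (norm_sub_le _ _).trans (add_le_add ?_ ?_)
      · rw [mul_left_comm, norm_mul]
        exact mul_le_of_le_one_left (norm_nonneg _) (hg1 _)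
      · rw [mul_left_comm, norm_mul, norm_mul, Complex.norm_real, Real.norm_of_nonneg (hr0 n).le]
        gcongr
        exact (mul_le_of_le_one_left (norm_nonneg _) (hr1 n)).trans (hC _)
    · refine Eventually.of_forall fun z => ?_
      simp_rw [hT]
      have hrz : Tendsto (fun n => r n • z) atTop (𝓝 0) := by
        simpa using hrlim.smul_const z
      have h1 : Tendsto (fun n => G n z) atTop (𝓝 1) := by
        rw [← hg0]
        exact (hgs.continuous.tendsto 0).comp hrz
      have h2 : Tendsto (fun n => (r n : ℂ) * dbar k g (r n • z)) atTop
          (𝓝 (((0 : ℝ) : ℂ) * dbar k g 0)) :=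
        ((Complex.continuous_ofReal.tendsto 0).comp hrlim).mul
          (((continuous_dbar k hgs).tendsto 0).comp hrz)
      have h3 := ((h1.mul_const (annihilationTranspose k f z)).sub
        (h2.mul_const (f z))).const_mul (ψ z)
      simpa using h3
  exact tendsto_nhds_unique hlim (by simp [hzero])

/-- On `ker b_k`, testing against `z̄_k q` is testing against `∂q/∂z_k`: this is
`b_k^* (q e^{-|z|²/2}) = (z̄_k q - ∂q/∂z_k) e^{-|z|²/2}`. -/
lemma inner_gaussPoly_X_inr_mul {k : Fin m} {ψ : L2 m} (hψ : (ψ, 0) ∈ annihilationGraph m k)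
    (q : Poly m) :
    inner ℂ (gaussPoly m (X (Sum.inr k) * q)) ψ
      = inner ℂ (gaussPoly m (pderiv (Sum.inl k) q)) ψ := by
  have h := integral_mul_annihilationTranspose_gaussPoly hψ (conjPoly q)
  simp_rw [annihilationTranspose_gaussPoly] at h
  have e : X (Sum.inl k) * conjPoly q - pderiv (Sum.inr k) (conjPoly q)
      = conjPoly (X (Sum.inr k) * q - pderiv (Sum.inl k) q) := by
    rw [map_sub, map_mul, conjPoly_X, ← pderiv_conjPoly]
    rfl
  rw [e, ← inner_gaussPoly_left, map_sub, inner_sub_left, sub_eq_zero] at h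
  exact h

end Annihilation

/-! ### Integrable functions with vanishing Fourier transform -/

section Fourier

variable {E : Type*} [NormedAddCommGroup E] [NormedSpace ℝ E] [CompleteSpace E]
  [SecondCountableTopology E] [MeasurableSpace E] [BorelSpace E] {μ : Measure E}

/-- The positive and the negative part of `u` are densities of finite measures with the same
characteristic function. -/
lemma ae_eq_zero_of_integral_ofReal_mul_cexp {u : E → ℝ} (hu : Integrable u μ)
    (h : ∀ L : StrongDual ℝ E, ∫ x, (u x : ℂ) * Complex.exp (L x * Complex.I) ∂μ = 0) :
    ∀ᵐ x ∂μ, u x = 0 := by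
  have hfin : ∀ {v : E → ℝ}, Integrable v μ →
      IsFiniteMeasure (μ.withDensity fun x => ENNReal.ofReal (v x)) := fun hv =>
    isFiniteMeasure_withDensity_ofReal hv.2
  have := hfin hu
  have := hfin hu.neg
  have hval : ∀ {v : E → ℝ}, Integrable v μ → ∀ L : StrongDual ℝ E,
      charFunDual (μ.withDensity fun x => ENNReal.ofReal (v x)) L
        = ∫ x, ((max (v x) 0 : ℝ) : ℂ) * Complex.exp (L x * Complex.I) ∂μ := by
    intro v hv L
    rw [charFunDual_apply, integral_withDensity_eq_integral_toReal_smul₀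
      hv.1.aemeasurable.ennreal_ofReal (by simp)]
    refine integral_congr_ae (Eventually.of_forall fun x => ?_)
    simp only [ENNReal.toReal_ofReal', Complex.real_smul]
  have hint : ∀ {v : E → ℝ}, Integrable v μ → ∀ L : StrongDual ℝ E,
      Integrable (fun x => ((max (v x) 0 : ℝ) : ℂ) * Complex.exp (L x * Complex.I)) μ := by
    intro v hv L
    refine hv.pos_part.ofReal.mul_bdd (c := 1) ?_ (Eventually.of_forall fun x => ?_)
    · exact Continuous.aestronglyMeasurable (by fun_prop)
    · rw [Complex.norm_exp_ofReal_mul_I]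
  have heq : (μ.withDensity fun x => ENNReal.ofReal (u x))
      = μ.withDensity fun x => ENNReal.ofReal ((-u) x) := by
    refine Measure.ext_of_charFunDual (funext fun L => ?_)
    rw [hval hu, hval hu.neg, ← sub_eq_zero, ← integral_sub (hint hu L) (hint hu.neg L), ← h L]
    refine integral_congr_ae (Eventually.of_forall fun x => ?_)
    simp only [Pi.neg_apply]
    rw [← sub_mul, ← Complex.ofReal_sub]
    congr 3
    rcases le_total 0 (u x) with hx | hx
    · rw [max_eq_left hx, max_eq_right (by linarith)]; ring
    · rw [max_eq_right hx, max_eq_left (by linarith)]; ring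
  have hae := (withDensity_eq_iff hu.1.aemeasurable.ennreal_ofReal
    hu.neg.1.aemeasurable.ennreal_ofReal hu.lintegral_lt_top.ne).mp heq
  filter_upwards [hae] with x hx
  have := congrArg ENNReal.toReal hx
  simp only [ENNReal.toReal_ofReal', Pi.neg_apply] at this
  rcases le_total 0 (u x) with h0 | h0
  · rw [max_eq_left h0, max_eq_right (by linarith)] at this; exact this
  · rw [max_eq_right h0, max_eq_left (by linarith)] at this; linarith

/-- An integrable function is determined by its Fourier transform. -/
theorem ae_eq_zero_of_integral_mul_cexp {f : E → ℂ} (hf : Integrable f μ)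
    (h : ∀ L : StrongDual ℝ E, ∫ x, f x * Complex.exp (L x * Complex.I) ∂μ = 0) :
    ∀ᵐ x ∂μ, f x = 0 := by
  have hint : ∀ {g : E → ℂ}, Integrable g μ → ∀ L : StrongDual ℝ E,
      Integrable (fun x => g x * Complex.exp (L x * Complex.I)) μ := by
    intro g hg L
    refine hg.mul_bdd (c := 1) ?_ (Eventually.of_forall fun x => ?_)
    · exact Continuous.aestronglyMeasurable (by fun_prop)
    · rw [Complex.norm_exp_ofReal_mul_I]
  have key : ∀ {g : E → ℂ}, Integrable g μ →
      (∀ L : StrongDual ℝ E, ∫ x, g x * Complex.exp (L x * Complex.I) ∂μ = 0) →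
      ∀ᵐ x ∂μ, (g x).re = 0 := by
    intro g hg hgL
    refine ae_eq_zero_of_integral_ofReal_mul_cexp hg.re fun L => ?_
    have hconj : ∫ x, (starRingEnd ℂ) (g x) * Complex.exp (L x * Complex.I) ∂μ = 0 := by
      have h1 := congrArg (starRingEnd ℂ) (hgL (-L))
      rw [← integral_conj, map_zero] at h1
      rw [← h1]
      refine integral_congr_ae (Eventually.of_forall fun x => ?_)
      simp [← Complex.exp_conj]
    have hgc : Integrable (fun x => (starRingEnd ℂ) (g x)) μ :=
      (Complex.conjCLE : ℂ →L[ℝ] ℂ).integrable_comp hg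
    have e : ∀ x, ((g x).re : ℂ) * Complex.exp (L x * Complex.I)
        = 1 / 2 * (g x * Complex.exp (L x * Complex.I))
          + 1 / 2 * ((starRingEnd ℂ) (g x) * Complex.exp (L x * Complex.I)) := by
      intro x
      rw [Complex.re_eq_add_conj]
      ring
    change ∫ x, ((g x).re : ℂ) * Complex.exp (L x * Complex.I) ∂μ = 0
    simp_rw [e]
    rw [integral_add ((hint hg L).const_mul _) ((hint hgc L).const_mul _)]
    simp only [integral_const_mul, hgL, hconj]
    simp
  have him := key (g := fun x => -Complex.I * f x) (hf.const_mul _) (fun L => by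
    simp_rw [mul_assoc]
    rw [integral_const_mul, h, mul_zero])
  filter_upwards [key hf h, him] with x h1 h2
  apply Complex.ext
  · simpa using h1
  · simpa using h2

end Fourier

/-! ### Totality of the Gaussian polynomials -/

section Totality

open MvPolynomial

variable {m : ℕ}

/-- A real-linear functional on `ℂ^m`, as a polynomial in `z` and `z̄`. -/
noncomputable def linPoly (L : StrongDual ℝ (Fin m → ℂ)) : Poly m :=
  ∑ k, (C ((L (Pi.single k 1) - Complex.I * L (Pi.single k Complex.I)) / 2) * X (Sum.inl k)
    + C ((L (Pi.single k 1) + Complex.I * L (Pi.single k Complex.I)) / 2) * X (Sum.inr k))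

lemma polyEval_linPoly (L : StrongDual ℝ (Fin m → ℂ)) (z : Fin m → ℂ) :
    polyEval (linPoly L) z = (L z : ℂ) := by
  have hz : z = ∑ k, ((z k).re • (Pi.single k 1 : Fin m → ℂ)
      + (z k).im • (Pi.single k Complex.I : Fin m → ℂ)) := by
    ext j
    simp only [Finset.sum_apply, Pi.add_apply, Pi.smul_apply]
    rw [Finset.sum_eq_single j (fun k _ hk => by simp [Pi.single_eq_of_ne hk.symm]) (by simp)]
    simp [Complex.re_add_im]
  have hL : L z = ∑ k, ((z k).re * L (Pi.single k 1)
      + (z k).im * L (Pi.single k Complex.I)) := by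
    conv_lhs => rw [hz]
    simp only [map_sum, map_add, map_smul, smul_eq_mul]
  rw [hL, linPoly]
  simp only [polyEval, map_sum, map_add, map_mul, eval_C, eval_X, Sum.elim_inl, Sum.elim_inr,
    Pi.star_apply]
  push_cast
  refine Finset.sum_congr rfl fun k _ => ?_
  rw [Complex.re_eq_add_conj, Complex.im_eq_sub_conj, ← starRingEnd_apply]
  field_simp
  linear_combination (L (Pi.single k Complex.I) : ℂ) *
    ((starRingEnd ℂ) (z k) - z k) * Complex.I_sq

/-- The functions `q(z, z̄) e^{-|z|²/2}` are total in `L²(ℂ^m)`: if `ψ` is orthogonal to all of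
them, expanding the exponential shows that the Fourier transform of `ψ e^{-|z|²/2}` vanishes. -/
theorem eq_zero_of_inner_gaussPoly {ψ : L2 m} (h : ∀ q, inner ℂ (gaussPoly m q) ψ = 0) : ψ = 0 := by
  have hq : ∀ q : Poly m, ∫ z, ψ z * (polyEval q z * gaussian z) = 0 := by
    intro q
    have := h (conjPoly q)
    rwa [inner_gaussPoly_left, conjPoly_conjPoly] at this
  have hint : Integrable (fun z => ψ z * gaussian z) := by
    have := integrable_mul (memLp_poly (1 : Poly m)) ψ
    simpa [polyEval] using this
  have hF : ∀ L : StrongDual ℝ (Fin m → ℂ),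
      ∫ z, (ψ z * gaussian z) * Complex.exp (L z * Complex.I) = 0 := by
    intro L
    let F : ℕ → (Fin m → ℂ) → ℂ := fun n z =>
      ψ z * (polyEval (C (Complex.I ^ n / n.factorial) * linPoly L ^ n) z * gaussian z)
    have hFz : ∀ n z, F n z = (ψ z * gaussian z) * ((L z * Complex.I) ^ n / n.factorial) := by
      intro n z
      simp only [F]
      rw [polyEval_mul, polyEval_C, polyEval, map_pow]
      change _ * (_ * polyEval (linPoly L) z ^ n * _) = _
      rw [polyEval_linPoly, mul_pow]
      ring
    have hsum : HasSum (fun n => ∫ z, F n z)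
        (∫ z, (ψ z * gaussian z) * Complex.exp (L z * Complex.I)) := by
      have hexp : ∀ z, HasSum (fun n : ℕ => ‖ψ z * gaussian z‖ * (|L z| ^ n / n.factorial))
          (‖ψ z * gaussian z‖ * Real.exp |L z|) := by
        intro z
        refine HasSum.mul_left _ ?_
        rw [Real.exp_eq_exp_ℝ]
        exact NormedSpace.expSeries_div_hasSum_exp _
      refine hasSum_integral_of_dominated_convergence
        (fun n z => ‖ψ z * gaussian z‖ * (|L z| ^ n / n.factorial))
        (fun n => (integrable_mul (memLp_poly _) ψ).aestronglyMeasurable)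
        (fun n => Eventually.of_forall fun z => ?_)
        (Eventually.of_forall fun z => (hexp z).summable) ?_
        (Eventually.of_forall fun z => ?_)
      · have hI : ‖(L z : ℂ) * Complex.I‖ = |L z| := by simp
        rw [hFz, norm_mul, norm_div, norm_pow, hI, Complex.norm_natCast]
      · simp_rw [fun z => (hexp z).tsum_eq]
        have hgrow : ExpGrowth fun z : Fin m → ℂ => (Real.exp |L z| : ℂ) := by
          refine ⟨1, ‖L‖, zero_le_one, norm_nonneg _, fun z => ?_⟩
          rw [one_mul, Complex.norm_real, Real.norm_of_nonneg (Real.exp_pos _).le]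
          gcongr
          refine (L.le_opNorm z).trans ?_
          gcongr
          exact (pi_norm_le_iff_of_nonneg (absSum_nonneg z)).mpr (norm_coord_le_absSum z)
        have hm := hgrow.memLp (by fun_prop)
        refine (integrable_mul hm ψ).norm.congr (Eventually.of_forall fun z => ?_)
        simp only [norm_mul, Complex.norm_real, Real.norm_of_nonneg (Real.exp_pos _).le]
        ring
      · simp_rw [hFz]
        refine HasSum.mul_left _ ?_
        rw [Complex.exp_eq_exp_ℂ]
        exact NormedSpace.expSeries_div_hasSum_exp _
    have h0 : (fun n => ∫ z, F n z) = fun _ => 0 := funext fun n => hq _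
    rw [h0] at hsum
    exact hsum.unique hasSum_zero
  have hae := ae_eq_zero_of_integral_mul_cexp hint hF
  refine (Lp.eq_zero_iff_ae_eq_zero).mpr ?_
  filter_upwards [hae] with z hz
  exact (mul_eq_zero.mp hz).resolve_right (gaussian_ne_zero z)

lemma dense_span_gaussPoly : Dense ((gaussPoly m).range : Set (L2 m)) := by
  rw [Submodule.dense_iff_topologicalClosure_eq_top, Submodule.topologicalClosure_eq_top_iff,
    Submodule.eq_bot_iff]
  intro ψ hψ
  refine eq_zero_of_inner_gaussPoly fun q => ?_
  exact (Submodule.mem_orthogonal _ _).mp hψ _ ⟨q, rfl⟩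

end Totality

/-! ### The kernel of the number operator -/

section UnboundedSums

variable {H : Type*} [NormedAddCommGroup H] [InnerProductSpace ℂ H]

lemma mem_graph_opMul_iff {S T : H →ₗ.[ℂ] H} {x y : H} :
    (x, y) ∈ (opMul S T).graph ↔ ∃ w, (x, w) ∈ T.graph ∧ (w, y) ∈ S.graph := by
  constructor
  · intro h
    obtain ⟨⟨_, x', hx', rfl⟩, rfl, rfl⟩ := (LinearPMap.mem_graph_iff _).mp h
    exact ⟨T x', T.mem_graph x', S.mem_graph ⟨T x', hx'⟩⟩
  · rintro ⟨w, h1, h2⟩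
    obtain ⟨x', rfl, rfl⟩ := (LinearPMap.mem_graph_iff _).mp h1
    obtain ⟨w', hw, rfl⟩ := (LinearPMap.mem_graph_iff _).mp h2
    have hx' : x' ∈ S.domain.comap T.toFun := by
      change T x' ∈ S.domain
      rw [← show (w' : H) = T x' from hw]
      exact w'.2
    refine (LinearPMap.mem_graph_iff _).mpr ⟨⟨x', x', hx', rfl⟩, rfl, ?_⟩
    change S ⟨T x', hx'⟩ = S w'
    exact congrArg S (Subtype.ext hw.symm)

lemma mem_graph_sum_iff {ι : Type*} (s : Finset ι) (T : ι → H →ₗ.[ℂ] H) {x y : H} :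
    (x, y) ∈ (∑ i ∈ s, T i).graph ↔
      ∃ v : ι → H, (∀ i ∈ s, (x, v i) ∈ (T i).graph) ∧ ∑ i ∈ s, v i = y := by
  classical
  induction s using Finset.induction_on generalizing y with
  | empty =>
    constructor
    · intro h
      obtain ⟨x', -, h2⟩ := (LinearPMap.mem_graph_iff _).mp h
      exact ⟨0, by simp, by rw [← show _ = y from h2]; rfl⟩
    · rintro ⟨v, -, rfl⟩
      exact (LinearPMap.mem_graph_iff _).mpr ⟨⟨x, trivial⟩, rfl, rfl⟩
  | insert a s ha ih =>
    rw [Finset.sum_insert ha]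
    constructor
    · intro h
      obtain ⟨x', rfl, rfl⟩ := (LinearPMap.mem_graph_iff _).mp h
      obtain ⟨v, hv1, hv2⟩ := ih.mp ((∑ i ∈ s, T i).mem_graph ⟨x', x'.2.2⟩)
      refine ⟨Function.update v a (T a ⟨x', x'.2.1⟩), ?_, ?_⟩
      · intro i hi
        rcases Finset.mem_insert.mp hi with rfl | hi
        · rw [Function.update_self]; exact (T i).mem_graph ⟨x', x'.2.1⟩
        · rw [Function.update_of_ne (ne_of_mem_of_not_mem hi ha)]; exact hv1 i hi
      · rw [Finset.sum_insert ha, Function.update_self, LinearPMap.add_apply, ← hv2]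
        congr 1
        exact Finset.sum_congr rfl fun i hi =>
          Function.update_of_ne (ne_of_mem_of_not_mem hi ha) _ _
    · rintro ⟨v, hv, rfl⟩
      obtain ⟨x1, h1, h2⟩ := (LinearPMap.mem_graph_iff _).mp (hv a (Finset.mem_insert_self a s))
      obtain ⟨x2, h3, h4⟩ := (LinearPMap.mem_graph_iff _).mp
        (ih.mpr ⟨v, fun i hi => hv i (Finset.mem_insert_of_mem hi), rfl⟩)
      simp only at h1 h2 h3 h4
      subst h1
      refine (LinearPMap.mem_graph_iff _).mpr ⟨⟨x1, x1.2, h3 ▸ x2.2⟩, rfl, ?_⟩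
      rw [LinearPMap.add_apply, Finset.sum_insert ha, ← h2, ← h4]
      congr 2
      exact Subtype.ext h3.symm

lemma mem_opKer_iff {T : H →ₗ.[ℂ] H} {x : H} : x ∈ opKer T ↔ (x, 0) ∈ T.graph := by
  rw [LinearPMap.mem_graph_iff]
  constructor
  · rintro ⟨x', h1, rfl⟩
    exact ⟨x', rfl, h1⟩
  · rintro ⟨x', h1, h2⟩
    exact ⟨x', h2, h1⟩

end UnboundedSums

section Vacuum

open MvPolynomial

variable {m : ℕ}

lemma dense_domain_annihilation (k : Fin m) : Dense ((annihilation m k).domain : Set (L2 m)) := by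
  refine dense_span_gaussPoly.mono ?_
  rintro _ ⟨q, rfl⟩
  have h : (gaussPoly m q, gaussPoly m (pderiv (Sum.inr k) q)) ∈ (annihilation m k).graph := by
    rw [annihilation_graph]
    exact gaussPoly_mem_annihilationGraph k q
  exact LinearPMap.mem_domain_of_mem_graph h

/-- `ker N_b` is the common kernel of the `b_k`, because `⟪ψ, N_b ψ⟫ = ∑ ‖b_k ψ‖²`. -/
theorem mem_opKer_numberOp_iff {ψ : L2 m} :
    ψ ∈ opKer (numberOp m) ↔ ∀ k, (ψ, 0) ∈ annihilationGraph m k := by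
  rw [mem_opKer_iff, numberOp, mem_graph_sum_iff]
  simp only [mem_graph_opMul_iff, annihilation_graph]
  constructor
  · rintro ⟨v, hv, hsum⟩
    choose w hw1 hw2 using fun k => hv k (Finset.mem_univ k)
    have hinner : ∀ k, inner ℂ (v k) ψ = ((‖w k‖ ^ 2 : ℝ) : ℂ) := by
      intro k
      obtain ⟨a, ha1, ha2⟩ := (LinearPMap.mem_graph_iff _).mp (hw2 k)
      have hb := hw1 k
      rw [← annihilation_graph] at hb
      obtain ⟨b, hb1, hb2⟩ := (LinearPMap.mem_graph_iff _).mp hb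
      have h := (annihilation m k).adjoint_isFormalAdjoint (dense_domain_annihilation k) a b
      simp only at ha1 ha2 hb1 hb2
      rw [ha2, ha1, hb1, hb2] at h
      rw [h, inner_self_eq_norm_sq_to_K]
      simp
    have h0 : ∑ k, ‖w k‖ ^ 2 = 0 := by
      have h1 : ∑ k, inner ℂ (v k) ψ = 0 := by rw [← sum_inner, hsum, inner_zero_left]
      simp only [hinner] at h1
      exact_mod_cast h1
    intro k
    have hk := (Finset.sum_eq_zero_iff_of_nonneg (fun k _ => sq_nonneg ‖w k‖)).mp h0 k
      (Finset.mem_univ k)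
    have hwk : w k = 0 := by simpa using hk
    rw [← hwk]
    exact hw1 k
  · intro h
    exact ⟨0, fun k _ => ⟨0, h k, Submodule.zero_mem _⟩, by simp⟩

/-- The space `ker N_b` of vacuum vectors, onto which `E_b` projects. As in the definition of the
projection, the closure is taken so that completeness is immediate. -/
noncomputable def vacuum (m : ℕ) : Submodule ℂ (L2 m) := (opKer (numberOp m)).topologicalClosure

instance : CompleteSpace (vacuum m) :=
  (Submodule.isClosed_topologicalClosure _).completeSpace_coe

lemma gaussPoly_rename_mem_vacuum (p : MvPolynomial (Fin m) ℂ) :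
    gaussPoly m (rename Sum.inl p) ∈ vacuum m := by
  refine Submodule.le_topologicalClosure _ (mem_opKer_numberOp_iff.mpr fun k => ?_)
  have h := gaussPoly_mem_annihilationGraph k (rename Sum.inl p)
  have h0 : pderiv (Sum.inr k) (rename Sum.inl p : Poly m) = 0 := by
    classical
    refine pderiv_eq_zero_of_notMem_vars fun hk => ?_
    have := vars_rename Sum.inl p hk
    simp at this
  rwa [h0, map_zero] at h

/-- The adjoint relation of the vacuum space: the projection of `z̄_k q e^{-|z|²/2}` to it is that
of `∂q/∂z_k e^{-|z|²/2}`. -/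
lemma inner_gaussPoly_X_inr_mul_of_mem_vacuum (k : Fin m) (q : Poly m) {ψ : L2 m}
    (hψ : ψ ∈ vacuum m) :
    inner ℂ (gaussPoly m (X (Sum.inr k) * q)) ψ
      = inner ℂ (gaussPoly m (pderiv (Sum.inl k) q)) ψ := by
  refine closure_minimal (s := (opKer (numberOp m) : Set (L2 m)))
    (t := {ψ | inner ℂ (gaussPoly m (X (Sum.inr k) * q)) ψ
      = inner ℂ (gaussPoly m (pderiv (Sum.inl k) q)) ψ}) (fun ψ hψ => ?_)
    (isClosed_eq (by fun_prop) (by fun_prop)) hψ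
  exact inner_gaussPoly_X_inr_mul (mem_opKer_numberOp_iff.mp hψ k) q

/-- The vectors `p(z) e^{-|z|²/2}` are total in `ker N_b`: by the adjoint relation a vector of
`ker N_b` orthogonal to them is orthogonal to all `q(z, z̄) e^{-|z|²/2}`. -/
theorem eq_zero_of_mem_vacuum {ψ : L2 m} (hψ : ψ ∈ vacuum m)
    (h : ∀ p : MvPolynomial (Fin m) ℂ, inner ℂ (gaussPoly m (rename Sum.inl p)) ψ = 0) : ψ = 0 := by
  refine eq_zero_of_inner_gaussPoly fun q => ?_
  -- induction on the degree in `z̄`, which the adjoint relation lowers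
  have key : ∀ (n : ℕ) (s : (Fin m ⊕ Fin m) →₀ ℕ), ∑ k, s (Sum.inr k) = n → ∀ c : ℂ,
      inner ℂ (gaussPoly m (monomial s c)) ψ = 0 := by
    intro n
    induction n with
    | zero =>
      intro s hs c
      have hs' : ∀ k, s (Sum.inr k) = 0 := fun k =>
        (Finset.sum_eq_zero_iff.mp hs) k (Finset.mem_univ k)
      have e : s = (s.comapDomain Sum.inl Sum.inl_injective.injOn).mapDomain Sum.inl := by
        ext i
        rcases i with i | i
        · rw [Finsupp.mapDomain_apply Sum.inl_injective, Finsupp.comapDomain_apply]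
        · rw [hs', Finsupp.mapDomain_of_notMem_range _ _ (by simp)]
      rw [e, ← rename_monomial]
      exact h _
    | succ n ih =>
      intro s hs c
      obtain ⟨k, hk⟩ : ∃ k, s (Sum.inr k) ≠ 0 := by
        by_contra! hcon
        simp [hcon] at hs
      have hle : Finsupp.single (Sum.inr k) 1 ≤ s := by
        rw [Finsupp.single_le_iff]; omega
      have e : monomial s c = X (Sum.inr k) * monomial (s - Finsupp.single (Sum.inr k) 1) c := by
        rw [X, monomial_mul, one_mul, add_tsub_cancel_of_le hle]
      rw [e, inner_gaussPoly_X_inr_mul_of_mem_vacuum k _ hψ, pderiv_monomial]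
      set s' : (Fin m ⊕ Fin m) →₀ ℕ :=
        s - Finsupp.single (Sum.inr k) 1 - Finsupp.single (Sum.inl k) 1 with hs'
      refine ih s' ?_ _
      have h1 : ∀ j, s' (Sum.inr j) + (if j = k then 1 else 0) = s (Sum.inr j) := by
        intro j
        rcases eq_or_ne j k with rfl | hj
        · simp [hs']; omega
        · simp [hs', hj]
      have h2 : ∑ j, s' (Sum.inr j) + 1 = n + 1 := by
        rw [← hs, ← Finset.sum_congr rfl fun j _ => h1 j, Finset.sum_add_distrib]
        simp
      omega
  induction q using MvPolynomial.induction_on' with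
  | monomial s c => exact key _ s rfl c
  | add p q hp hq => rw [map_add, inner_add_left, hp, hq, add_zero]

end Vacuum

/-! ### The grading of the vacuum space by degree -/

section Grading

open MvPolynomial

variable {m : ℕ}

/-- The vector `p(z) e^{-|z|²/2}` of the vacuum space, for `p` a polynomial in `z`. -/
noncomputable def holPoly (m : ℕ) : MvPolynomial (Fin m) ℂ →ₗ[ℂ] L2 m :=
  gaussPoly m ∘ₗ (rename Sum.inl : MvPolynomial (Fin m) ℂ →ₐ[ℂ] Poly m).toLinearMap

lemma holPoly_apply (p : MvPolynomial (Fin m) ℂ) :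
    holPoly m p = gaussPoly m (rename Sum.inl p) := rfl

lemma holPoly_mem_vacuum (p : MvPolynomial (Fin m) ℂ) : holPoly m p ∈ vacuum m :=
  gaussPoly_rename_mem_vacuum p

lemma holPoly_X_mul (k : Fin m) (p : MvPolynomial (Fin m) ℂ) :
    holPoly m (X k * p) = gaussPoly m (X (Sum.inl k) * rename Sum.inl p) := by
  rw [holPoly_apply, map_mul, rename_X]

/-- On the vacuum space `z̄_k` acts as `∂/∂z_k`. -/
lemma inner_X_inr_mul_rename (k : Fin m) (p : MvPolynomial (Fin m) ℂ) {ψ : L2 m}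
    (hψ : ψ ∈ vacuum m) :
    inner ℂ (gaussPoly m (X (Sum.inr k) * rename Sum.inl p)) ψ
      = inner ℂ (holPoly m (pderiv k p)) ψ := by
  rw [inner_gaussPoly_X_inr_mul_of_mem_vacuum k _ hψ, pderiv_rename Sum.inl_injective,
    holPoly_apply]

/-- Multiplication by `z_k` and the derivative `∂/∂z_k` are adjoint to each other. -/
lemma inner_holPoly_X_mul (k : Fin m) (p q : MvPolynomial (Fin m) ℂ) :
    inner ℂ (holPoly m (X k * p)) (holPoly m q)
      = inner ℂ (holPoly m p) (holPoly m (pderiv k q)) := by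
  rw [holPoly_X_mul, holPoly_apply q, inner_gaussPoly_mul, conjPoly_X, ← holPoly_apply,
    ← inner_conj_symm]
  change (starRingEnd ℂ)
    (inner ℂ (gaussPoly m (X (Sum.inr k) * rename Sum.inl q)) (holPoly m p)) = _
  rw [inner_X_inr_mul_rename k q (holPoly_mem_vacuum p), inner_conj_symm]

/-- Vectors of different degrees are orthogonal: they are eigenvectors of the Euler operator
`∑ z_k ∂/∂z_k`, which is symmetric, for different eigenvalues. -/
lemma inner_holPoly_eq_zero {a b : ℕ} (hab : a ≠ b) {p q : MvPolynomial (Fin m) ℂ}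
    (hp : p.IsHomogeneous a) (hq : q.IsHomogeneous b) :
    inner ℂ (holPoly m p) (holPoly m q) = 0 := by
  have h1 : inner ℂ (holPoly m (a • p)) (holPoly m q)
      = inner ℂ (holPoly m p) (holPoly m (b • q)) := by
    rw [← hp.sum_X_mul_pderiv, ← hq.sum_X_mul_pderiv, map_sum, map_sum, sum_inner, inner_sum]
    refine Finset.sum_congr rfl fun k _ => ?_
    rw [inner_holPoly_X_mul, ← inner_conj_symm (holPoly m p), inner_holPoly_X_mul,
      inner_conj_symm]
  rw [map_nsmul, map_nsmul, ← Nat.cast_smul_eq_nsmul ℂ, ← Nat.cast_smul_eq_nsmul ℂ,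
    inner_smul_left, inner_smul_right, Complex.conj_natCast] at h1
  have h2 : ((a : ℂ) - b) * inner ℂ (holPoly m p) (holPoly m q) = 0 := by
    rw [sub_mul, h1, sub_self]
  refine (mul_eq_zero.mp h2).resolve_left (sub_ne_zero.mpr ?_)
  exact_mod_cast hab

/-- `∑ (∂/∂z_k) z_k = m + ∑ z_k ∂/∂z_k`, and the Euler operator is `a` in degree `a`. -/
lemma sum_norm_sq_holPoly_X_mul {a : ℕ} {p : MvPolynomial (Fin m) ℂ} (hp : p.IsHomogeneous a) :
    ∑ k, ‖holPoly m (X k * p)‖ ^ 2 = (m + a) * ‖holPoly m p‖ ^ 2 := by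
  have h : ∑ k, inner ℂ (holPoly m (X k * p)) (holPoly m (X k * p))
      = ((m : ℂ) + a) * inner ℂ (holPoly m p) (holPoly m p) := by
    simp_rw [inner_holPoly_X_mul, pderiv_mul, pderiv_X_self, one_mul]
    rw [← inner_sum, ← map_sum, Finset.sum_add_distrib, hp.sum_X_mul_pderiv, Finset.sum_const,
      Finset.card_univ, Fintype.card_fin, ← add_smul, map_nsmul, ← Nat.cast_smul_eq_nsmul ℂ,
      inner_smul_right]
    push_cast
    rfl
  simp_rw [inner_self_eq_norm_sq_to_K] at h
  rw [← Complex.ofReal_inj]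
  push_cast
  exact h

/-- Multiplication by `z_k` and by `z̄_k` give vectors of the same norm. -/
lemma norm_gaussPoly_X_mul_swap (i : Fin m ⊕ Fin m) (q : Poly m) :
    ‖gaussPoly m (X i.swap * q)‖ = ‖gaussPoly m (X i * q)‖ := by
  have h : inner ℂ (gaussPoly m (X i.swap * q)) (gaussPoly m (X i.swap * q))
      = inner ℂ (gaussPoly m (X i * q)) (gaussPoly m (X i * q)) := by
    rw [inner_gaussPoly_mul, inner_gaussPoly_mul, conjPoly_X, conjPoly_X, Sum.swap_swap,
      mul_left_comm]
  rw [inner_self_eq_norm_sq_to_K, inner_self_eq_norm_sq_to_K] at h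
  have h2 : ‖gaussPoly m (X i.swap * q)‖ ^ 2 = ‖gaussPoly m (X i * q)‖ ^ 2 := by exact_mod_cast h
  exact (sq_eq_sq₀ (norm_nonneg _) (norm_nonneg _)).mp h2

/-- Multiplication by a coordinate or its conjugate costs at most a factor `√(m + a)` in
degree `a`. -/
lemma norm_gaussPoly_X_mul_rename_le (i : Fin m ⊕ Fin m) {a : ℕ} {p : MvPolynomial (Fin m) ℂ}
    (hp : p.IsHomogeneous a) :
    ‖gaussPoly m (X i * rename Sum.inl p)‖ ≤ √(m + a) * ‖holPoly m p‖ := by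
  have key : ∀ k : Fin m, ‖gaussPoly m (X (Sum.inl k) * rename Sum.inl p)‖
      ≤ √(m + a) * ‖holPoly m p‖ := by
    intro k
    rw [← holPoly_X_mul]
    refine le_of_sq_le_sq ?_ (by positivity)
    rw [mul_pow, Real.sq_sqrt (by positivity), ← sum_norm_sq_holPoly_X_mul hp]
    exact Finset.single_le_sum (f := fun k => ‖holPoly m (X k * p)‖ ^ 2)
      (fun _ _ => by positivity) (Finset.mem_univ k)
  rcases i with k | k
  · exact key k
  · exact (norm_gaussPoly_X_mul_swap (Sum.inl k) _).trans_le (key k)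

/-- The homogeneous part of degree `n` of the vacuum space. -/
noncomputable def gradedPart (m n : ℕ) : Submodule ℂ (L2 m) :=
  (homogeneousSubmodule (Fin m) ℂ n).map (holPoly m)

instance (n : ℕ) : FiniteDimensional ℂ (gradedPart m n) :=
  Module.Finite.iff_fg.mpr ((homogeneousSubmodule_fg _ _ n).map _)

lemma exists_of_mem_gradedPart {n : ℕ} {x : L2 m} (hx : x ∈ gradedPart m n) :
    ∃ p : MvPolynomial (Fin m) ℂ, p.IsHomogeneous n ∧ holPoly m p = x := hx

lemma mem_gradedPart {n : ℕ} {p : MvPolynomial (Fin m) ℂ} (hp : p.IsHomogeneous n) :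
    holPoly m p ∈ gradedPart m n := ⟨p, hp, rfl⟩

end Grading

/-! ### Quadratic symbols -/

section QuadraticSymbols

open MvPolynomial

variable {m : ℕ}

/-- The quadratic polynomial `∑ c_{ij} w_i w_j`, where `w = (z, z̄)`. -/
noncomputable def quadPoly (c : Fin m ⊕ Fin m → Fin m ⊕ Fin m → ℂ) : Poly m :=
  ∑ i, ∑ j, C (c i j) * (X i * X j)

lemma gaussPoly_quadPoly_mul (c : Fin m ⊕ Fin m → Fin m ⊕ Fin m → ℂ) (q : Poly m) :
    gaussPoly m (quadPoly c * q) = ∑ i, ∑ j, c i j • gaussPoly m (X i * (X j * q)) := by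
  simp_rw [quadPoly, Finset.sum_mul, map_sum, mul_assoc, ← smul_eq_C_mul, map_smul]

/-- The Toeplitz operator of a quadratic symbol raises the degree by at most `2`. -/
lemma inner_gaussPoly_quadPoly_eq_zero (c : Fin m ⊕ Fin m → Fin m ⊕ Fin m → ℂ) {n : ℕ}
    {p : MvPolynomial (Fin m) ℂ} (hp : p.IsHomogeneous n) {χ : L2 m} (hχ : χ ∈ vacuum m)
    (h : ∀ d ≤ n + 2, ∀ x ∈ gradedPart m d, inner ℂ x χ = 0) :
    inner ℂ (gaussPoly m (quadPoly c * rename Sum.inl p)) χ = 0 := by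
  rw [gaussPoly_quadPoly_mul, sum_inner]
  refine Finset.sum_eq_zero fun i _ => ?_
  rw [sum_inner]
  refine Finset.sum_eq_zero fun j _ => ?_
  rw [inner_smul_left]
  refine mul_eq_zero_of_right _ ?_
  have hX : ∀ k, (X k * p).IsHomogeneous (n + 1) := fun k => by
    rw [add_comm]; exact (isHomogeneous_X ℂ k).mul hp
  rcases i with i | i <;> rcases j with j | j
  · have e : (X (Sum.inl i) * (X (Sum.inl j) * rename Sum.inl p) : Poly m)
        = rename Sum.inl (X i * (X j * p)) := by simp only [map_mul, rename_X]
    rw [e, ← holPoly_apply]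
    refine h (n + 2) le_rfl _ (mem_gradedPart ?_)
    rw [show n + 2 = 1 + (n + 1) by ring]
    exact (isHomogeneous_X ℂ i).mul (hX j)
  · rw [mul_left_comm, ← rename_X (Sum.inl) i, ← map_mul, inner_X_inr_mul_rename j _ hχ]
    exact h n (by omega) _ (mem_gradedPart (hX i).pderiv)
  · rw [← rename_X (Sum.inl) j, ← map_mul, inner_X_inr_mul_rename i _ hχ]
    exact h n (by omega) _ (mem_gradedPart (hX j).pderiv)
  · rw [inner_gaussPoly_X_inr_mul_of_mem_vacuum i _ hχ, pderiv_mul, pderiv_X_of_ne (by simp),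
      zero_mul, zero_add, pderiv_rename Sum.inl_injective, inner_X_inr_mul_rename j _ hχ]
    exact h (n - 1 - 1) (by omega) _ (mem_gradedPart hp.pderiv.pderiv)

/-- The matrix elements of a quadratic symbol grow at most linearly in the degree. -/
lemma norm_inner_gaussPoly_quadPoly_le (c : Fin m ⊕ Fin m → Fin m ⊕ Fin m → ℂ) {a b M : ℕ}
    (ha : a ≤ M) (hb : b ≤ M) {p q : MvPolynomial (Fin m) ℂ} (hp : p.IsHomogeneous a)
    (hq : q.IsHomogeneous b) :
    ‖inner ℂ (gaussPoly m (quadPoly c * rename Sum.inl p)) (holPoly m q)‖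
      ≤ (∑ i, ∑ j, ‖c i j‖) * ((m + M) * (‖holPoly m p‖ * ‖holPoly m q‖)) := by
  rw [gaussPoly_quadPoly_mul, sum_inner, Finset.sum_mul]
  refine (norm_sum_le _ _).trans (Finset.sum_le_sum fun i _ => ?_)
  rw [sum_inner, Finset.sum_mul]
  refine (norm_sum_le _ _).trans (Finset.sum_le_sum fun j _ => ?_)
  rw [inner_smul_left, norm_mul, RCLike.norm_conj, holPoly_apply q, inner_gaussPoly_mul]
  refine mul_le_mul_of_nonneg_left ?_ (norm_nonneg _)
  rw [conjPoly_X, ← holPoly_apply q]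
  refine (norm_inner_le_norm _ _).trans ?_
  have h1 := norm_gaussPoly_X_mul_rename_le j hp
  have h2 := norm_gaussPoly_X_mul_rename_le i.swap hq
  have h3 : √((m : ℝ) + a) ≤ √(m + M) := by gcongr
  have h4 : √((m : ℝ) + b) ≤ √(m + M) := by gcongr
  have h5 : √((m : ℝ) + M) * √(m + M) = m + M := Real.mul_self_sqrt (by positivity)
  calc _ ≤ (√(m + M) * ‖holPoly m p‖) * (√(m + M) * ‖holPoly m q‖) := by
        refine mul_le_mul (h1.trans ?_) (h2.trans ?_) (norm_nonneg _) (by positivity)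
        · gcongr
        · gcongr
    _ = _ := by linear_combination (‖holPoly m p‖ * ‖holPoly m q‖) * h5

/-- Multiplication by an imaginary symbol is skew-symmetric. -/
lemma re_inner_gaussPoly_mul_self {h : Poly m} (hre : ∀ z, (polyEval h z).re = 0) (q : Poly m) :
    (inner ℂ (gaussPoly m (h * q)) (gaussPoly m q)).re = 0 := by
  have e : gaussPoly m (conjPoly h * q) = -gaussPoly m (h * q) := by
    rw [← map_neg]
    refine MemLp.toLp_congr (memLp_poly _) (memLp_poly _) (Eventually.of_forall fun z => ?_)
    have hz : (starRingEnd ℂ) (polyEval h z) = -polyEval h z := by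
      apply Complex.ext
      · simp [hre z]
      · simp
    have hn : polyEval (-(h * q)) z = -polyEval (h * q) z := map_neg _ _
    simp only [hn, polyEval_mul, polyEval_conjPoly, hz]
    ring
  have h1 := inner_gaussPoly_mul h q q
  rw [e, inner_neg_right, ← inner_conj_symm] at h1
  have h2 := congrArg Complex.re h1
  have h3 := congrArg Complex.re
    (inner_conj_symm (𝕜 := ℂ) (gaussPoly m (h * q)) (gaussPoly m q))
  simp only [Complex.conj_re, Complex.neg_re] at h2 h3
  linarith

end QuadraticSymbols

/-! ### A Carleman criterion -/

section Carleman

open MvPolynomial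

/-- If the partial sums of a summable sequence are bounded by its terms times a linear factor,
the sequence vanishes, because the harmonic series diverges. -/
lemma eq_zero_of_sum_le {a : ℕ → ℝ} (ha : ∀ n, 0 ≤ a n) (hs : Summable a) {K : ℝ}
    (h : ∀ N : ℕ, ∑ n ∈ Finset.range (N + 2), a n
      ≤ K * (N + 1) * (a N + a (N + 1) + a (N + 2) + a (N + 3))) (n : ℕ) : a n = 0 := by
  by_contra hn
  have hδ : 0 < a n := lt_of_le_of_ne (ha n) (Ne.symm hn)
  have hb : Summable fun N => a N + a (N + 1) + a (N + 2) + a (N + 3) :=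
    ((hs.add ((summable_nat_add_iff 1).mpr hs)).add ((summable_nat_add_iff 2).mpr hs)).add
      ((summable_nat_add_iff 3).mpr hs)
  have hbd : ∀ N : ℕ, a n * (1 / ((N + n : ℕ) + 1 : ℝ))
      ≤ K * (a (N + n) + a (N + n + 1) + a (N + n + 2) + a (N + n + 3)) := by
    intro N
    have h1 := h (N + n)
    have h2 : a n ≤ ∑ k ∈ Finset.range (N + n + 2), a k :=
      Finset.single_le_sum (f := a) (fun k _ => ha k) (Finset.mem_range.mpr (by omega))
    rw [mul_one_div, div_le_iff₀ (by positivity)]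
    linarith
  have hsum : Summable fun N : ℕ => a n * (1 / ((N + n : ℕ) + 1 : ℝ)) :=
    Summable.of_nonneg_of_le (fun N => by positivity) hbd
      (((summable_nat_add_iff n).mpr hb).mul_left K)
  rw [summable_mul_left_iff hδ.ne', summable_nat_add_iff (f := fun N : ℕ => 1 / ((N : ℝ) + 1)) n]
    at hsum
  have h3 := (summable_nat_add_iff (f := fun N : ℕ => 1 / (N : ℝ)) 1).mp (by simpa using hsum)
  exact Real.not_summable_one_div_natCast h3

variable {m : ℕ}

/-- The deficiency spaces of the Toeplitz operator of an imaginary quadratic symbol vanish. If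
`φ ⊥ (1 - s T) p` for all polynomials `p`, take for `p` the part of `φ` of degree `≤ N + 1`: since
`T` is skew-symmetric, only the matrix elements between degrees `N, …, N + 3` contribute to
`‖p‖² = s ⟪φ, T p⟫`, and they are `O(N)`. -/
theorem eq_zero_of_inner_quadPoly {c : Fin m ⊕ Fin m → Fin m ⊕ Fin m → ℂ}
    (hc : ∀ z, (polyEval (quadPoly c) z).re = 0) {s : ℝ} {φ : L2 m} (hφ : φ ∈ vacuum m)
    (h : ∀ p, inner ℂ (holPoly m p) φ
      = s * inner ℂ (gaussPoly m (quadPoly c * rename Sum.inl p)) φ) : φ = 0 := by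
  let P : ℕ → L2 m := fun n => (gradedPart m n).starProjection φ
  have hPmem : ∀ n, P n ∈ gradedPart m n := fun n => Submodule.starProjection_apply_mem _ _
  choose p hp hpP using fun n => exists_of_mem_gradedPart (hPmem n)
  have hinner : ∀ n, ∀ x ∈ gradedPart m n, inner ℂ x φ = inner ℂ x (P n) := by
    intro n x hx
    rw [← sub_eq_zero, ← inner_sub_right]
    exact ((gradedPart m n).sub_starProjection_mem_orthogonal φ) x hx
  have horth : ∀ {n k : ℕ}, n ≠ k → ∀ x ∈ gradedPart m n, inner ℂ x (P k) = 0 := by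
    intro n k hnk x hx
    obtain ⟨q, hq, rfl⟩ := exists_of_mem_gradedPart hx
    rw [← hpP k]
    exact inner_holPoly_eq_zero hnk hq (hp k)
  have hPvac : ∀ n, P n ∈ vacuum m := fun n => hpP n ▸ holPoly_mem_vacuum _
  let S : ℕ → L2 m := fun N => ∑ n ∈ Finset.range N, P n
  have hSS : ∀ N d, d < N → ∀ x ∈ gradedPart m d, inner ℂ x (S N) = inner ℂ x (P d) := by
    intro N d hd x hx
    simp only [S]
    rw [inner_sum]
    exact Finset.sum_eq_single d (fun k _ hk => horth hk.symm x hx)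
      (fun h => absurd (Finset.mem_range.mpr hd) h)
  have hSφ : ∀ N, (inner ℂ (S N) φ).re = ∑ n ∈ Finset.range N, ‖P n‖ ^ 2 := by
    intro N
    simp only [S]
    rw [sum_inner, Complex.re_sum]
    refine Finset.sum_congr rfl fun n _ => ?_
    rw [hinner n _ (hPmem n), inner_self_eq_norm_sq_to_K]
    simp [← Complex.ofReal_pow]
  have hSnorm : ∀ N, ‖S N‖ ^ 2 = ∑ n ∈ Finset.range N, ‖P n‖ ^ 2 := by
    intro N
    have h1 : inner ℂ (S N) (S N) = inner ℂ (S N) φ := by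
      simp only [S]
      rw [sum_inner, sum_inner]
      refine Finset.sum_congr rfl fun n hn => ?_
      exact (hSS N n (Finset.mem_range.mp hn) _ (hPmem n)).trans (hinner n _ (hPmem n)).symm
    rw [← hSφ, ← h1, inner_self_eq_norm_sq_to_K]
    simp [← Complex.ofReal_pow]
  -- Bessel's inequality
  have hsummable : Summable fun n => ‖P n‖ ^ 2 := by
    refine summable_of_sum_range_le (c := ‖φ‖ ^ 2) (fun n => sq_nonneg _) fun N => ?_
    have h1 : (inner ℂ (S N) φ).re ≤ ‖S N‖ * ‖φ‖ :=
      (Complex.re_le_norm _).trans (norm_inner_le_norm _ _)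
    rw [hSφ, ← hSnorm] at h1
    rw [← hSnorm]
    nlinarith [sq_nonneg (‖S N‖ - ‖φ‖)]
  set K₀ := ∑ i, ∑ j, ‖c i j‖ with hK₀
  have hK₀0 : 0 ≤ K₀ := Finset.sum_nonneg fun i _ => Finset.sum_nonneg fun j _ => norm_nonneg _
  have hP0 : ∀ n, ‖P n‖ ^ 2 = 0 := by
    refine eq_zero_of_sum_le (K := |s| * K₀ * (m + 3)) (fun n => sq_nonneg _) hsummable fun N => ?_
    let w : ℕ → L2 m := fun n => gaussPoly m (quadPoly c * rename Sum.inl (p n))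
    let q : MvPolynomial (Fin m) ℂ := ∑ n ∈ Finset.range (N + 2), p n
    have hq : holPoly m q = S (N + 2) := by simp only [q, S, map_sum, hpP]
    set W := gaussPoly m (quadPoly c * rename Sum.inl q) with hW
    have hWsum : W = ∑ n ∈ Finset.range (N + 2), w n := by
      simp only [hW, q, w, map_sum, Finset.mul_sum]
    -- `w n` has no components of degree above `n + 2`
    have hwP : ∀ n k, n + 2 < k → inner ℂ (w n) (P k) = 0 := fun n k hnk =>
      inner_gaussPoly_quadPoly_eq_zero c (hp n) (hPvac k)
        fun d hd x hx => horth (by omega) x hx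
    have hwχ : inner ℂ W (φ - S (N + 4)) = 0 := by
      rw [hWsum, sum_inner]
      refine Finset.sum_eq_zero fun n hn => inner_gaussPoly_quadPoly_eq_zero c (hp n)
        (sub_mem hφ (sum_mem fun k _ => hPvac k)) fun d hd x hx => ?_
      have := Finset.mem_range.mp hn
      rw [inner_sub_right, hSS (N + 4) d (by omega) x hx, hinner d x hx, sub_self]
    have hW2 : inner ℂ W (P (N + 2))
        = inner ℂ (w N) (P (N + 2)) + inner ℂ (w (N + 1)) (P (N + 2)) := by
      rw [hWsum, sum_inner, Finset.sum_range_succ, Finset.sum_range_succ,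
        Finset.sum_eq_zero (fun n hn => hwP n _ (by have := Finset.mem_range.mp hn; omega)),
        zero_add]
    have hW3 : inner ℂ W (P (N + 3)) = inner ℂ (w (N + 1)) (P (N + 3)) := by
      rw [hWsum, sum_inner, Finset.sum_range_succ,
        Finset.sum_eq_zero (fun n hn => hwP n _ (by have := Finset.mem_range.mp hn; omega)),
        zero_add]
    have hWS : (inner ℂ W (S (N + 2))).re = 0 := by
      rw [← hq]
      exact re_inner_gaussPoly_mul_self hc _
    have hdecomp : φ = S (N + 2) + P (N + 2) + P (N + 3) + (φ - S (N + 4)) := by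
      have : S (N + 4) = S (N + 2) + P (N + 2) + P (N + 3) := by
        simp only [S, Finset.sum_range_succ]
      rw [this]; abel
    have hWφ : (inner ℂ W φ).re = (inner ℂ (w N) (P (N + 2))).re
        + (inner ℂ (w (N + 1)) (P (N + 2))).re + (inner ℂ (w (N + 1)) (P (N + 3))).re := by
      rw [hdecomp, inner_add_right, inner_add_right, inner_add_right, hwχ, hW2, hW3]
      simp only [Complex.add_re, hWS, Complex.zero_re]
      ring
    have hbd : ∀ n k, n ≤ N + 3 → k ≤ N + 3 → |(inner ℂ (w n) (P k)).re|
        ≤ K₀ * ((m + (N + 3 : ℕ)) * (‖P n‖ * ‖P k‖)) := by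
      intro n k hn hk
      refine (Complex.abs_re_le_norm _).trans ?_
      have := norm_inner_gaussPoly_quadPoly_le c hn hk (hp n) (hp k)
      rwa [hpP, hpP] at this
    have hmain : ∑ n ∈ Finset.range (N + 2), ‖P n‖ ^ 2 = s * (inner ℂ W φ).re := by
      rw [← hSφ, ← hq, h q, Complex.re_ofReal_mul]
    rw [hmain]
    have h1 := hbd N (N + 2) (by omega) (by omega)
    have h2 := hbd (N + 1) (N + 2) (by omega) (by omega)
    have h3 := hbd (N + 1) (N + 3) (by omega) (by omega)
    have hre : |(inner ℂ W φ).re| ≤ K₀ * ((m + (N + 3 : ℕ)) *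
        (‖P N‖ ^ 2 + ‖P (N + 1)‖ ^ 2 + ‖P (N + 2)‖ ^ 2 + ‖P (N + 3)‖ ^ 2)) := by
      rw [hWφ]
      refine (abs_add_three _ _ _).trans ((add_le_add (add_le_add h1 h2) h3).trans ?_)
      rw [← mul_add, ← mul_add, ← mul_add, ← mul_add]
      refine mul_le_mul_of_nonneg_left (mul_le_mul_of_nonneg_left ?_ (by positivity)) hK₀0
      nlinarith [sq_nonneg (‖P N‖ - ‖P (N + 2)‖), sq_nonneg (‖P (N + 1)‖ - ‖P (N + 2)‖),
        sq_nonneg (‖P (N + 1)‖ - ‖P (N + 3)‖), sq_nonneg ‖P N‖, sq_nonneg ‖P (N + 3)‖]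
    calc s * (inner ℂ W φ).re ≤ |s| * |(inner ℂ W φ).re| := by
          rw [← abs_mul]; exact le_abs_self _
      _ ≤ |s| * (K₀ * (((m + 3) * (N + 1)) *
        (‖P N‖ ^ 2 + ‖P (N + 1)‖ ^ 2 + ‖P (N + 2)‖ ^ 2 + ‖P (N + 3)‖ ^ 2))) := by
          refine mul_le_mul_of_nonneg_left (hre.trans ?_) (abs_nonneg _)
          have : (m : ℝ) + (N + 3 : ℕ) ≤ (m + 3) * (N + 1) := by
            push_cast
            nlinarith [(Nat.cast_nonneg m : (0 : ℝ) ≤ m), (Nat.cast_nonneg N : (0 : ℝ) ≤ N),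
              mul_nonneg (Nat.cast_nonneg m : (0 : ℝ) ≤ m) (Nat.cast_nonneg N : (0 : ℝ) ≤ N)]
          gcongr
      _ = _ := by ring
  refine eq_zero_of_mem_vacuum hφ fun q => ?_
  rw [← holPoly_apply, ← sum_homogeneousComponent q, map_sum, sum_inner]
  refine Finset.sum_eq_zero fun n _ => ?_
  rw [hinner n _ (mem_gradedPart (homogeneousComponent_isHomogeneous n q))]
  have : P n = 0 := by simpa using hP0 n
  rw [this, inner_zero_right]

end Carleman

/-! ### Antinormally ordered quantizations -/

section Quantization

open MvPolynomial

variable {m : ℕ}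

lemma mem_graph_ofBounded_iff {H : Type*} [NormedAddCommGroup H] [InnerProductSpace ℂ H]
    {T : H →L[ℂ] H} {x y : H} : (x, y) ∈ (ofBounded T).graph ↔ T x = y := by
  rw [LinearPMap.mem_graph_iff]
  constructor
  · rintro ⟨x', rfl, rfl⟩; rfl
  · rintro rfl; exact ⟨⟨x, trivial⟩, rfl, rfl⟩

lemma mem_graph_mulOp_iff {f : (Fin m → ℂ) → ℂ} {x y : L2 m} :
    (x, y) ∈ (mulOp f).graph ↔ y =ᵐ[volume] fun z => f z * x z := by
  rw [LinearPMap.mem_graph_iff]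
  constructor
  · rintro ⟨x', rfl, h⟩
    rw [← show _ = y from h]
    exact MemLp.coeFn_toLp x'.2
  · intro h
    have hm : MemLp (fun z => f z * x z) 2 volume := (memLp_congr_ae h).mp (Lp.memLp y)
    refine ⟨⟨x, hm⟩, rfl, Lp.ext ?_⟩
    exact (MemLp.coeFn_toLp hm).trans h.symm

lemma mem_graph_quantization_iff {f : (Fin m → ℂ) → ℂ} {x y : L2 m} :
    (x, y) ∈ (quantization f).graph ↔
      ∃ η : L2 m, (η =ᵐ[volume] fun z => f z * vacuumProj m x z) ∧ vacuumProj m η = y := by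
  rw [quantization, mem_graph_opMul_iff]
  simp only [mem_graph_opMul_iff, mem_graph_ofBounded_iff, mem_graph_mulOp_iff]
  constructor
  · rintro ⟨η, ⟨_, rfl, h⟩, h'⟩; exact ⟨η, h, h'⟩
  · rintro ⟨η, h, h'⟩; exact ⟨η, ⟨_, rfl, h⟩, h'⟩

lemma inner_vacuumProj_left (x y : L2 m) :
    inner ℂ (vacuumProj m x) y = inner ℂ x (vacuumProj m y) :=
  (vacuum m).inner_starProjection_left_eq_right x y

lemma vacuumProj_of_mem {x : L2 m} (hx : x ∈ vacuum m) : vacuumProj m x = x :=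
  Submodule.starProjection_eq_self_iff.mpr hx

/-- For an imaginary quadratic symbol, `1 - s T` has dense range for all real `s`. -/
lemma dense_range_quantization {c : Fin m ⊕ Fin m → Fin m ⊕ Fin m → ℂ}
    (hc : ∀ z, (polyEval (quadPoly c) z).re = 0) (s : ℝ) :
    Dense (Set.range fun ψ : (quantization (polyEval (quadPoly c))).domain =>
      (ψ : L2 m) - (s : ℂ) • quantization (polyEval (quadPoly c)) ψ) := by
  set T := quantization (polyEval (quadPoly c)) with hT
  let R : T.domain →ₗ[ℂ] L2 m := T.domain.subtype - (s : ℂ) • T.toFun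
  have hR : (Set.range fun ψ : T.domain => (ψ : L2 m) - (s : ℂ) • T ψ)
      = (R.range : Set (L2 m)) := by
    rw [LinearMap.coe_range]
    rfl
  rw [hR, Submodule.dense_iff_topologicalClosure_eq_top, Submodule.topologicalClosure_eq_top_iff,
    Submodule.eq_bot_iff]
  intro φ hφ
  have horth : ∀ p : L2 m × L2 m, p ∈ T.graph → inner ℂ (p.1 - (s : ℂ) • p.2) φ = 0 := by
    rintro ⟨x, y⟩ hp
    obtain ⟨ψ, rfl, rfl⟩ := (LinearPMap.mem_graph_iff T).mp hp
    exact (Submodule.mem_orthogonal _ _).mp hφ _ ⟨ψ, rfl⟩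
  -- the quantization vanishes on the orthogonal complement of the vacuum space
  have hvac : φ ∈ vacuum m := by
    rw [← (vacuum m).orthogonal_orthogonal, Submodule.mem_orthogonal]
    intro x hx
    have hx0 : vacuumProj m x = 0 := (Submodule.starProjection_apply_eq_zero_iff _).mpr hx
    have h := horth (x, 0) (mem_graph_quantization_iff.mpr ⟨0, ?_, map_zero _⟩)
    · simpa using h
    · rw [hx0]
      filter_upwards [Lp.coeFn_zero ℂ 2 (volume : Measure (Fin m → ℂ))] with z hz
      simp
  refine eq_zero_of_inner_quadPoly hc (s := s) hvac fun p => ?_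
  have h := horth (holPoly m p, vacuumProj m (gaussPoly m (quadPoly c * rename Sum.inl p)))
    (mem_graph_quantization_iff.mpr ⟨_, ?_, rfl⟩)
  · simp only at h
    rw [inner_sub_left, inner_smul_left, Complex.conj_ofReal,
      inner_vacuumProj_left, vacuumProj_of_mem hvac, sub_eq_zero] at h
    exact h
  · rw [vacuumProj_of_mem (holPoly_mem_vacuum p)]
    filter_upwards [coeFn_gaussPoly (quadPoly c * rename Sum.inl p),
      coeFn_gaussPoly (rename Sum.inl p : Poly m)] with z h1 h2
    rw [h1, holPoly_apply, h2, polyEval_mul, mul_assoc]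

/-- The quantization of a bounded continuous symbol, as a bounded operator. -/
lemma exists_bounded_quantization {f : (Fin m → ℂ) → ℂ} (hf : Continuous f) {C : ℝ}
    (hC : ∀ z, ‖f z‖ ≤ C) :
    ∃ A : L2 m →L[ℂ] L2 m, ∀ x y, (x, y) ∈ (quantization f).graph ↔ A x = y := by
  have hmem : ∀ x : L2 m, MemLp (fun z => f z * x z) 2 volume := fun x =>
    (Lp.memLp x).of_le_mul (c := C) (hf.aestronglyMeasurable.mul (Lp.aestronglyMeasurable x))
      (Eventually.of_forall fun z => by
        rw [norm_mul]; exact mul_le_mul_of_nonneg_right (hC z) (norm_nonneg _))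
  let M : L2 m →L[ℂ] L2 m := LinearMap.mkContinuous
    { toFun := fun x => (hmem x).toLp
      map_add' := fun x y => by
        rw [← MemLp.toLp_add]
        apply MemLp.toLp_congr
        filter_upwards [Lp.coeFn_add x y] with z hz
        simp only [Pi.add_apply, hz, mul_add]
      map_smul' := fun c x => by
        rw [RingHom.id_apply, ← MemLp.toLp_const_smul]
        apply MemLp.toLp_congr
        filter_upwards [Lp.coeFn_smul c x] with z hz
        simp [hz, mul_left_comm] } C (fun x => by
      refine Lp.norm_le_mul_norm_of_ae_le_mul ?_
      filter_upwards [(hmem x).coeFn_toLp] with z hz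
      change ‖(hmem x).toLp _ z‖ ≤ _
      rw [hz, norm_mul]
      exact mul_le_mul_of_nonneg_right (hC z) (norm_nonneg _))
  have hM : ∀ x : L2 m, M x =ᵐ[volume] fun z => f z * x z := fun x => (hmem x).coeFn_toLp
  refine ⟨vacuumProj m * M * vacuumProj m, fun x y => ?_⟩
  rw [mem_graph_quantization_iff]
  constructor
  · rintro ⟨η, h, rfl⟩
    have : η = M (vacuumProj m x) := Lp.ext (h.trans (hM _).symm)
    rw [this]
    rfl
  · intro h
    exact ⟨M (vacuumProj m x), hM _, h⟩

/-- The quantization of an imaginary symbol is skew-symmetric. -/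
lemma inner_quantization {f : (Fin m → ℂ) → ℂ} (hre : ∀ z, (f z).re = 0) {p q : L2 m × L2 m}
    (hp : p ∈ (quantization f).graph) (hq : q ∈ (quantization f).graph) :
    inner ℂ p.2 q.1 = -inner ℂ p.1 q.2 := by
  obtain ⟨η, h1, h2⟩ := mem_graph_quantization_iff.mp hp
  obtain ⟨ζ, h3, h4⟩ := mem_graph_quantization_iff.mp hq
  rw [← h2, ← h4, inner_vacuumProj_left η, ← inner_vacuumProj_left p.1, L2.inner_def, L2.inner_def,
    ← integral_neg]
  refine integral_congr_ae ?_
  filter_upwards [h1, h3] with z hz1 hz3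
  have hz : (starRingEnd ℂ) (f z) = -f z := by
    apply Complex.ext
    · simp [hre z]
    · simp
  rw [hz1, hz3, RCLike.inner_apply, RCLike.inner_apply, map_mul, hz]
  ring

/-- The quantization of a bounded continuous imaginary symbol, as a bounded skew-adjoint
operator. -/
lemma exists_skewAdjoint_quantization {f : (Fin m → ℂ) → ℂ} (hf : Continuous f) {C : ℝ}
    (hC : ∀ z, ‖f z‖ ≤ C) (hre : ∀ z, (f z).re = 0) :
    ∃ A ∈ skewAdjoint (L2 m →L[ℂ] L2 m), ∀ x y, (x, y) ∈ (quantization f).graph ↔ A x = y := by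
  obtain ⟨A, hA⟩ := exists_bounded_quantization hf hC
  refine ⟨A, ?_, hA⟩
  rw [skewAdjoint.mem_iff, ContinuousLinearMap.star_eq_adjoint]
  refine (ContinuousLinearMap.eq_adjoint_iff _ _).mpr (fun x y => ?_) |>.symm
  have := inner_quantization hre ((hA x _).mpr rfl) ((hA y _).mpr rfl)
  simp only at this
  rw [neg_apply, inner_neg_left, this, neg_neg]

end Quantization

/-! ### Truncation of the symbol -/

section Truncation

open MvPolynomial

variable {m : ℕ}

/-- Dominated convergence in `L²`, with the limit as the dominating function. -/
lemma tendsto_of_dominated {ι : Type*} {l : Filter ι} [l.IsCountablyGenerated] {η : ι → L2 m}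
    {g : ι → (Fin m → ℂ) → ℂ} {ξ : L2 m} (hη : ∀ i, η i =ᵐ[volume] g i)
    (hdom : ∀ᶠ i in l, ∀ᵐ z, ‖g i z - ξ z‖ ≤ ‖ξ z‖)
    (hlim : ∀ᵐ z, Tendsto (fun i => g i z) l (𝓝 (ξ z))) : Tendsto η l (𝓝 ξ) := by
  rw [tendsto_iff_norm_sub_tendsto_zero]
  have hsq : ∀ x : L2 m, ‖x‖ ^ 2 = ∫ z, ‖x z‖ ^ 2 := by
    intro x
    have h1 : ((‖x‖ ^ 2 : ℝ) : ℂ) = inner ℂ x x := by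
      rw [inner_self_eq_norm_sq_to_K]; simp
    rw [← Complex.ofReal_inj, h1, L2.inner_def, ← integral_complex_ofReal]
    refine integral_congr_ae (Eventually.of_forall fun z => ?_)
    simp only [inner_self_eq_norm_sq_to_K]
    simp
  have hint : ∀ x : L2 m, Integrable fun z => ‖x z‖ ^ 2 := fun x =>
    (memLp_two_iff_integrable_sq_norm (Lp.aestronglyMeasurable x)).mp (Lp.memLp x)
  have hae : ∀ i, (fun z => ‖(η i - ξ) z‖ ^ 2) =ᵐ[volume] fun z => ‖g i z - ξ z‖ ^ 2 := by
    intro i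
    filter_upwards [Lp.coeFn_sub (η i) ξ, hη i] with z h1 h2
    rw [h1, Pi.sub_apply, h2]
  have hlim2 : Tendsto (fun i => ‖η i - ξ‖ ^ 2) l (𝓝 0) := by
    simp_rw [hsq, fun i => integral_congr_ae (hae i)]
    rw [← integral_zero (Fin m → ℂ) ℝ]
    refine tendsto_integral_filter_of_dominated_convergence (fun z => ‖ξ z‖ ^ 2)
      (Eventually.of_forall fun i => ((hint _).congr (hae i)).aestronglyMeasurable) ?_ (hint ξ) ?_
    · filter_upwards [hdom] with i hi
      filter_upwards [hi] with z hz
      rw [Real.norm_of_nonneg (by positivity)]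
      gcongr
    · filter_upwards [hlim] with z hz
      simpa using (hz.sub_const (ξ z)).norm.pow 2
  have := (Real.continuous_sqrt.tendsto 0).comp hlim2
  simpa [Function.comp_def, Real.sqrt_sq] using this

/-- The Hamiltonian pairs `(z, z̄)` with `(z̄, z)`, whence the swap of the second index. -/
lemma hamiltonian_eq_polyEval (X : Matrix (Fin m ⊕ Fin m) (Fin m ⊕ Fin m) ℂ) :
    hamiltonian X
      = polyEval (quadPoly fun i j => 1 / 2 * (signMatrix m * X) i j.swap) := by
  funext z
  have hswap : ∀ j, Sum.elim (star z) z j = Sum.elim z (star z) j.swap := by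
    rintro (j | j) <;> rfl
  simp only [hamiltonian, dotProduct, Matrix.mulVec, polyEval, quadPoly, map_sum, map_mul, eval_C,
    eval_X, Finset.mul_sum]
  refine Finset.sum_congr rfl fun i _ => ?_
  rw [← Equiv.sum_comp (Equiv.sumComm (Fin m) (Fin m))]
  refine Finset.sum_congr rfl fun j _ => ?_
  rw [hswap, Equiv.sumComm_apply, Sum.swap_swap]
  ring

lemma continuous_hamiltonian (X : Matrix (Fin m ⊕ Fin m) (Fin m ⊕ Fin m) ℂ) :
    Continuous (hamiltonian X) := by
  rw [hamiltonian_eq_polyEval]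
  exact (contDiff_polyEval _).continuous

variable (X : Matrix (Fin m ⊕ Fin m) (Fin m ⊕ Fin m) ℂ) (τ : ℝ)

lemma continuous_cutoffHamiltonian : Continuous (cutoffHamiltonian X τ) := by
  have h := Complex.continuous_re.comp ((continuous_const (y := Complex.I)).mul
    (continuous_hamiltonian X))
  exact continuous_const.mul
    (Complex.continuous_ofReal.comp ((h.min continuous_const).max continuous_const))

lemma norm_cutoffHamiltonian_le (z : Fin m → ℂ) : ‖cutoffHamiltonian X τ z‖ ≤ |τ| := by
  rw [cutoffHamiltonian, norm_mul, norm_div, norm_one, Complex.norm_I, div_one, one_mul,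
    Complex.norm_real, Real.norm_eq_abs, abs_le]
  constructor
  · exact (neg_le_neg (le_abs_self τ)).trans (le_max_right _ _)
  · exact max_le ((min_le_right _ _).trans (le_abs_self τ)) (neg_le_abs τ)

lemma re_cutoffHamiltonian (z : Fin m → ℂ) : (cutoffHamiltonian X τ z).re = 0 := by
  rw [cutoffHamiltonian, Complex.re_mul_ofReal]
  simp

variable {X τ}

lemma hamiltonian_eq (hX : X ∈ spc m) (z : Fin m → ℂ) :
    hamiltonian X z = 1 / Complex.I * (((Complex.I * hamiltonian X z).re : ℝ) : ℂ) := by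
  have h := hamiltonian_re hX z
  apply Complex.ext <;> simp [h]

lemma cutoffHamiltonian_eq (hX : X ∈ spc m) {z : Fin m → ℂ}
    (hτ : |(Complex.I * hamiltonian X z).re| ≤ τ) : cutoffHamiltonian X τ z = hamiltonian X z := by
  rw [hamiltonian_eq hX z, cutoffHamiltonian, min_eq_left (abs_le.mp hτ).2,
    max_eq_left (abs_le.mp hτ).1]

lemma norm_cutoffHamiltonian_sub_le (hX : X ∈ spc m) (hτ : 0 ≤ τ) (z : Fin m → ℂ) :
    ‖cutoffHamiltonian X τ z - hamiltonian X z‖ ≤ ‖hamiltonian X z‖ := by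
  have key : ∀ r : ℝ, |max (min r τ) (-τ) - r| ≤ |r| := by
    intro r
    rcases le_total r τ with h1 | h1
    · rw [min_eq_left h1]
      rcases le_total r (-τ) with h2 | h2
      · rw [max_eq_right h2, abs_of_nonneg (by linarith), abs_of_nonpos (by linarith)]
        linarith
      · rw [max_eq_left h2, sub_self, abs_zero]
        exact abs_nonneg r
    · rw [min_eq_right h1, max_eq_left (by linarith), abs_of_nonpos (by linarith),
        abs_of_nonneg (by linarith)]
      linarith
  rw [hamiltonian_eq hX z, cutoffHamiltonian, ← mul_sub, norm_mul, norm_mul,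
    ← Complex.ofReal_sub, Complex.norm_real, Complex.norm_real]
  exact mul_le_mul_of_nonneg_left (key _) (norm_nonneg _)

/-- On the domain of the quantized Hamiltonian the quantized cutoff Hamiltonians converge. -/
lemma tendsto_cutoff_quantization (hX : X ∈ spc m) {A : ℝ → L2 m →L[ℂ] L2 m}
    (hA : ∀ τ x y, (x, y) ∈ (quantization (cutoffHamiltonian X τ)).graph ↔ A τ x = y)
    {x y : L2 m} (h : (x, y) ∈ (quantization (hamiltonian X)).graph) :
    Tendsto (fun τ => A τ x) atTop (𝓝 y) := by
  obtain ⟨ξ, hξ, rfl⟩ := mem_graph_quantization_iff.mp h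
  choose η hη hηA using fun τ => mem_graph_quantization_iff.mp ((hA τ x _).mpr rfl)
  have hlim : Tendsto η atTop (𝓝 ξ) := by
    refine tendsto_of_dominated hη ?_ ?_
    · filter_upwards [eventually_ge_atTop 0] with τ hτ
      filter_upwards [hξ] with z hz
      rw [hz, ← sub_mul, norm_mul, norm_mul]
      exact mul_le_mul_of_nonneg_right (norm_cutoffHamiltonian_sub_le hX hτ z) (norm_nonneg _)
    · filter_upwards [hξ] with z hz
      rw [hz]
      refine tendsto_const_nhds.congr' ?_
      filter_upwards [eventually_ge_atTop |(Complex.I * hamiltonian X z).re|] with τ hτ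
      rw [cutoffHamiltonian_eq hX hτ]
  exact (((vacuumProj m).continuous.tendsto ξ).comp hlim).congr hηA

end Truncation

end AntinormalQuantization

open AntinormalQuantization in
theorem mainTheorem7 (m : ℕ) (X : Matrix (Fin m ⊕ Fin m) (Fin m ⊕ Fin m) ℂ) (hX : X ∈ spc m) :
    (IsEssentiallySkewAdjoint (quantization (hamiltonian X)) ∧
      ∃! U, IsUnitaryGroupGeneratedBy U (quantization (hamiltonian X))) ∧
    (∀ τ : ℝ, 0 < τ → IsEssentiallySkewAdjoint (quantization (cutoffHamiltonian X τ)) ∧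
      ∃! U, IsUnitaryGroupGeneratedBy U (quantization (cutoffHamiltonian X τ))) ∧
    ∀ (t : ℝ) (ψ : L2 m),
      Tendsto (fun τ : ℝ => unitaryExp (quantization (cutoffHamiltonian X τ)) t ψ) atTop
        (𝓝 (unitaryExp (quantization (hamiltonian X)) t ψ)) := by
  choose A hA hAgraph using fun τ => exists_skewAdjoint_quantization
    (continuous_cutoffHamiltonian X τ) (norm_cutoffHamiltonian_le X τ) (re_cutoffHamiltonian X τ)
  have hran : ∀ s : ℝ, Dense (Set.range fun ψ : (quantization (hamiltonian X)).domain =>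
      (ψ : L2 m) - (s : ℂ) • quantization (hamiltonian X) ψ) := by
    have hre := hamiltonian_re hX
    rw [hamiltonian_eq_polyEval] at hre ⊢
    exact dense_range_quantization hre
  obtain ⟨h1, h2, h3⟩ := tendsto_unitaryExp hA hAgraph hran
    fun ψ => tendsto_cutoff_quantization hX hAgraph (LinearPMap.mem_graph _ ψ)
  exact ⟨h1, fun τ _ => h2 τ, h3⟩
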